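/- Let $K>0$ and $\rho>0$. Let $(P,\alpha)$ be a classical solution of the free boundary problem for the American put price under the square-root CEV model $dS=rS\,dt+\sigma\sqrt S\,dW$ in scaled variables ($K$ is the strike, $t\ge 0$ is the time to expiry multiplied by $\sigma^2/2$, and $\rho=2r/\sigma^2$). That is: - $\alpha:[0,\infty)\to(0,\infty)$ is continuous, is $C^1$ on $(0,\infty)$, and $\alpha(0)=K$. - $P$ is continuous on $\{t\ge 0,\ S\ge\alpha(t)\}$; $P_S$ is continuous on $\{t>0,\ S\ge\alpha(t)\}$; $P_t$ and $P_{SS}$ exist and are continuous on $\{t>0,\ S>\alpha(t)\}$, where $$P_t=S P_{SS}+\rho S P_S-\rho P .$$ - $P(S,0)=\max(K-S,0)$ for $S>0$; $P(\alpha(t),t)=K-\alpha(t)$ for $t\ge0$; $P_S(\alpha(t),t)=-1$ for $t>0$; and $P(S,t)=K-S$ for $t\ge 0$, $0<S<\alpha(t)$. - $P(S,t)\to 0$ as $S\to\infty$, uniformly for $t$ in bounded subsets of $[0,\infty)$. Put $\tilde P(V,t)=P(V+\alpha(t),t)-K+V+\alpha(t)$ for $V>0$, and for real $\theta>0$ and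 $t\ge0$ put $$Q(\theta,t)=\frac{K\rho}{\theta^2}\,e^{\alpha(t)\theta}\int_{\theta/\rho}^{\infty}\frac{1}{z+1}\exp\Big[-\rho z\,\alpha\Big(t+\rho^{-1}\log\Big(\frac{\theta+\rho}{\theta}\,\frac{z}{z+1}\Big)\Big)\Big]\,dz. \qquad (1)$$ Then: 1. For every $t\ge 0$ the integral in (1) converges absolutely for all $\theta>0$, and $Q(\cdot,t)$ extends (uniquely) to a holomorphic function on $\{\Re\theta>0\}$, also denoted $Q(\cdot,t)$. For $\Re\theta>0$ it is given by the absolutely convergent integral $Q(\theta,t)=\int_0^\infty e^{-\theta V}\tilde P(V,t)\,dV$. For all $t\ge 0$, $S>0$ and $c>0$, $$P(S,t)=K-S+\frac1{2\pi i}\int_{c-i\infty}^{c+i\infty}e^{\theta V}Q(\theta,t)\,d\theta,\qquad V=S-\alpha(t),$$ where the Bromwich integral converges as $\lim_{R\to\infty}\int_{c-iR}^{c+iR}$. 2. The function (1) has partial derivatives in $t$ and in $\theta$ for $\theta,t>0$ and satisfies $$Q_t+(\theta^2+\rho\theta)Q_\theta=\big[\alpha'(t)\theta+(\theta^2+\rho\theta)\alpha(t)-(2\theta+2\rho)\big]Q-\frac{\rho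 K}{\theta},$$ and $Q(\theta,0)=\theta^{-2}$ for $\theta>0$. 3. The free boundary satisfies, for every $\theta>0$, the nonlinear integral equation $$\frac{e^{-K\theta}}{K\rho}=\int_{\theta/\rho}^{\infty}\frac{1}{z+1}\exp\Big[-\rho z\,\alpha\Big(\rho^{-1}\log\Big(\frac{\theta+\rho}{\theta}\,\frac{z}{z+1}\Big)\Big)\Big]\,dz .$$ -/

import Mathlib

open Set Filter Topology MeasureTheory

/-- `(P, α)` is a classical solution of the American put free boundary problem in the square-root
CEV model, in scaled variables: `S` is the asset price, `t ≥ 0` the scaled time to expiry, `K` the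
strike, `ρ = 2 r / σ ^ 2`, `P S t` the price and `α t` the exercise boundary.
Nothing is required of `P` for `S ≤ 0` or of `P`, `α` for `t < 0`. -/
structure IsAmericanPutSolution (K ρ : ℝ) (α : ℝ → ℝ) (P : ℝ → ℝ → ℝ) : Prop where
  /-- The free boundary is positive and continuous for `t ≥ 0`, and `C ^ 1` for `t > 0`. -/
  boundary_pos : ∀ t, 0 ≤ t → 0 < α t
  boundary_continuousOn : ContinuousOn α (Ici 0)
  boundary_contDiffOn : ContDiffOn ℝ 1 α (Ioi 0)
  boundary_zero : α 0 = K
  /-- `P` is continuous on the closed continuation region, down to `t = 0`. -/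
  price_continuousOn :
    ContinuousOn (fun x : ℝ × ℝ => P x.1 x.2) {x | 0 ≤ x.2 ∧ α x.2 ≤ x.1}
  /-- `P_S`, `P_SS`, `P_t` exist in the continuation region. -/
  differentiableAt_S : ∀ t, 0 < t → ∀ S, α t < S → DifferentiableAt ℝ (fun x => P x t) S
  differentiableAt_SS :
    ∀ t, 0 < t → ∀ S, α t < S → DifferentiableAt ℝ (deriv fun x => P x t) S
  differentiableAt_t : ∀ t, 0 < t → ∀ S, α t < S → DifferentiableAt ℝ (fun τ => P S τ) t
  /-- `P_S` is continuous up to the free boundary for `t > 0`. -/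
  deriv_S_continuousOn :
    ContinuousOn (fun x : ℝ × ℝ => deriv (fun S => P S x.2) x.1) {x | 0 < x.2 ∧ α x.2 ≤ x.1}
  deriv_SS_continuousOn :
    ContinuousOn (fun x : ℝ × ℝ => deriv (deriv fun S => P S x.2) x.1)
      {x | 0 < x.2 ∧ α x.2 < x.1}
  deriv_t_continuousOn :
    ContinuousOn (fun x : ℝ × ℝ => deriv (fun τ => P x.1 τ) x.2) {x | 0 < x.2 ∧ α x.2 < x.1}
  /-- `P_t = S P_SS + ρ S P_S - ρ P` in the continuation region. -/
  pde : ∀ t, 0 < t → ∀ S, α t < S →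
    deriv (fun τ => P S τ) t =
      S * deriv (deriv fun x => P x t) S + ρ * S * deriv (fun x => P x t) S - ρ * P S t
  /-- Payoff at expiry. -/
  initial : ∀ S, 0 < S → P S 0 = max (K - S) 0
  /-- Value matching and smooth pasting at the free boundary. -/
  value_matching : ∀ t, 0 ≤ t → P (α t) t = K - α t
  smooth_pasting : ∀ t, 0 < t → HasDerivAt (fun S => P S t) (-1) (α t)
  /-- Below the free boundary the option is exercised. -/
  exercise : ∀ t, 0 ≤ t → ∀ S, 0 < S → S < α t → P S t = K - S
  /-- `P S t → 0` as `S → ∞`, locally uniformly in `t ≥ 0`. -/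
  far_field : ∀ T, 0 < T → TendstoUniformlyOn P 0 atTop (Icc 0 T)

/-- `P̃(V, t) = P(V + α(t), t) - K + (V + α(t))`, so that `P(S, t) = K - S + P̃(S - α(t), t)`. -/
noncomputable def shiftedPrice (K : ℝ) (α : ℝ → ℝ) (P : ℝ → ℝ → ℝ) (V t : ℝ) : ℝ :=
  P (V + α t) t - K + (V + α t)

/-- `(z + 1)⁻¹ exp[-ρ z α(t + ρ⁻¹ log(((θ + ρ) / θ) (z / (z + 1))))]`. -/
noncomputable def charIntegrand (ρ : ℝ) (α : ℝ → ℝ) (θ t z : ℝ) : ℝ :=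
  1 / (z + 1) *
    Real.exp (-ρ * z * α (t + ρ⁻¹ * Real.log ((θ + ρ) / θ * (z / (z + 1)))))

/-- `(K ρ / θ ^ 2) exp(α(t) θ) ∫_{θ/ρ}^∞ charIntegrand dz`, for real `θ > 0`. -/
noncomputable def charQ (K ρ : ℝ) (α : ℝ → ℝ) (θ t : ℝ) : ℝ :=
  K * ρ / θ ^ 2 * Real.exp (α t * θ) * ∫ z in Ioi (θ / ρ), charIntegrand ρ α θ t z

/-- The Bromwich integral `(2πi)⁻¹ ∫ f(θ) dθ` along the upward line `Re θ = c`, as the limit of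
the integrals over `c - iR → c + iR`, converges to `l`. -/
def HasBromwichIntegral (f : ℂ → ℂ) (c : ℝ) (l : ℂ) : Prop :=
  Tendsto (fun R : ℝ => 1 / (2 * (Real.pi : ℂ) * Complex.I) *
    ∫ y in (-R)..R, f ((c : ℂ) + (y : ℂ) * Complex.I) * Complex.I) atTop (𝓝 l)

/-! The substitution `V = S - α(t)` fixes the free boundary at `V = 0` and gives an equation for
`P̃` whose coefficients are affine in `V`. The Laplace transform in `V` therefore turns it into a
linear first-order equation in `(θ, t)`. The boundary contributes nothing, because value matching
and smooth pasting say that `P̃` and `P̃_V` vanish at `V = 0`.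

The characteristics of the transformed equation solve `dθ/dt = θ² + ρθ` and escape to `θ = ∞` in
finite time. With `θ = ρz` as parameter, `(ρz)² exp(-ρzα)` is an integrating factor, and the product
with the transform has the derivative `-ρK` times the integrand of (1) (`hasDerivAt_charFlow`).
Along a characteristic the time stays in a compact interval, where `α` is bounded below by a
positive constant, so the product tends to `0` as `z → ∞` (`tendsto_charFlow`). Integrating from `z
= θ/ρ` to `∞` yields (1) (`charQ_eq_realLaplace`). Since the data come from `θ = ∞` and not from `t
= 0`, the initial transform `θ⁻²` is an additional condition, and (1) at `t = 0` becomes the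
integral equation for `α`.

The delicate point is the transformed equation itself: only `P → 0` is known at infinity, with no
control of `P_S` or `P_t` there or near the corner `t = 0`. The Laplace kernel is therefore
truncated so that it vanishes to second order at `V = 1/m`, all derivatives are moved onto it, the
identity is integrated in time, and `m → 0` is taken by domination (`truncKernel_rate`,
`realLaplace_sub_eq_integral`). The price is recovered by pointwise Fourier inversion, since the
extension of `P̃` by `0` is Lipschitz at every point that matters (`hasBromwichIntegral_laplace`).
-/

/-! ### Pointwise Fourier and Bromwich inversion. -/

open scoped FourierTransform in
/-- An integrable function vanishing at the origin to first order has a Fourier transform whose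
symmetric integrals tend to `0`. -/
theorem tendsto_intervalIntegral_fourier_of_isBigO {g : ℝ → ℂ} (hg : Integrable g)
    (h0 : g =O[𝓝 0] fun v : ℝ => v) :
    Tendsto (fun R : ℝ => ∫ y in (-R)..R, 𝓕 g y) atTop (𝓝 0) := by
  have hg0 : g 0 = 0 := by
    obtain ⟨C, hC⟩ := h0.bound
    simpa using hC.self_of_nhds
  -- `g(v)/v` is still integrable, and `𝓕 g` is a constant multiple of the derivative of its
  -- transform. The symmetric integral thus telescopes to `𝓕 k R - 𝓕 k (-R)`, and Riemann–Lebesgue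
  -- finishes.
  set k : ℝ → ℂ := fun v => (v : ℂ)⁻¹ * g v with hk
  have hkm : AEStronglyMeasurable k volume :=
    (Complex.measurable_ofReal.inv.aestronglyMeasurable).mul hg.aestronglyMeasurable
  have hki : Integrable k := by
    obtain ⟨C, hC⟩ := h0.bound
    obtain ⟨δ, hδ, hb⟩ := Metric.eventually_nhds_iff.1 hC
    have hC0 : 0 ≤ |C| := abs_nonneg C
    have hi : Integrable (fun v : ℝ => (Metric.ball (0 : ℝ) δ).indicator (fun _ => |C|) v
        + δ⁻¹ * ‖g v‖) := by
      refine Integrable.add ?_ (hg.norm.const_mul _)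
      exact (integrable_indicator_iff Metric.isOpen_ball.measurableSet).2
        (integrableOn_const (measure_ball_lt_top).ne)
    refine hi.mono' hkm (ae_of_all _ fun v => ?_)
    have hn : ‖k v‖ = |v|⁻¹ * ‖g v‖ := by simp [hk]
    rw [hn]
    by_cases hv : v ∈ Metric.ball (0 : ℝ) δ
    · rw [indicator_of_mem hv]
      have h1 := hb (Metric.mem_ball.1 hv)
      have h2 : |v|⁻¹ * ‖g v‖ ≤ |C| := by
        rcases eq_or_ne v 0 with rfl | hv0
        · simp
        · have hp : 0 < |v| := abs_pos.2 hv0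
          rw [inv_mul_le_iff₀ hp]
          calc ‖g v‖ ≤ C * ‖v‖ := h1
            _ ≤ |v| * |C| := by
              rw [Real.norm_eq_abs, mul_comm]
              exact mul_le_mul_of_nonneg_left (le_abs_self C) hp.le
      have h3 : 0 ≤ δ⁻¹ * ‖g v‖ := by positivity
      linarith
    · rw [indicator_of_notMem hv, zero_add]
      have h1 : δ ≤ |v| := by simpa [Metric.mem_ball] using hv
      gcongr
  have hmul : ∀ v : ℝ, v • k v = g v := by
    intro v
    rcases eq_or_ne v 0 with rfl | hv0
    · simp [hg0]
    · have : (v : ℂ) ≠ 0 := by exact_mod_cast hv0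
      simp only [hk, Complex.real_smul]
      field_simp
  have hki' : Integrable (fun v : ℝ => v • k v) := hg.congr (ae_of_all _ fun v => (hmul v).symm)
  have hd : ∀ y : ℝ, HasDerivAt (𝓕 k) (-2 * Real.pi * Complex.I * 𝓕 g y) y := by
    intro y
    convert! Real.hasDerivAt_fourier hki hki' y using 1
    rw [Real.fourier_real_eq, Real.fourier_real_eq, ← integral_const_mul]
    congr 1 with v
    rw [← hmul v, Circle.smul_def, Circle.smul_def, Complex.real_smul]
    simp only [smul_eq_mul]
    ring
  have hcont : Continuous (𝓕 g) :=
    VectorFourier.fourierIntegral_continuous Real.continuous_fourierChar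
      (L := innerₗ ℝ) (by exact continuous_inner) hg
  have hint : ∀ R : ℝ, ∫ y in (-R)..R, 𝓕 g y =
      (-2 * Real.pi * Complex.I)⁻¹ * (𝓕 k R - 𝓕 k (-R)) := by
    intro R
    have hne : (-2 * Real.pi * Complex.I : ℂ) ≠ 0 := by
      simp [Real.pi_ne_zero]
    rw [← intervalIntegral.integral_eq_sub_of_hasDerivAt (fun y _ => hd y)
      ((continuous_const.mul hcont).intervalIntegrable _ _), intervalIntegral.integral_const_mul,
      inv_mul_cancel_left₀ hne]
  have hz := Real.zero_at_infty_fourier k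
  have hz1 : Tendsto (fun R : ℝ => 𝓕 k R) atTop (𝓝 0) :=
    hz.mono_left atTop_le_cocompact
  have hz2 : Tendsto (fun R : ℝ => 𝓕 k (-R)) atTop (𝓝 0) :=
    (hz.mono_left atBot_le_cocompact).comp tendsto_neg_atTop_atBot
  simp_rw [hint]
  simpa using (hz1.sub hz2).const_mul ((-2 * Real.pi * Complex.I)⁻¹)

open scoped FourierTransform in
/-- Pointwise Fourier inversion at a point where the function is Lipschitz. -/
theorem tendsto_intervalIntegral_fourier {f : ℝ → ℂ} {x : ℝ} (hf : Integrable f)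
    (hx : (fun v => f v - f x) =O[𝓝 x] fun v => v - x) :
    Tendsto (fun R : ℝ => ∫ y in (-R)..R, Complex.exp ((2 * Real.pi * x * y : ℝ) * Complex.I) * 𝓕 f y)
      atTop (𝓝 (f x)) := by
  -- Subtracting `f x` times a Gaussian from the translate of `f` reduces to a function vanishing to
  -- first order at `0`. The Gaussian is its own transform and has integral `1`, so its share of the
  -- limit is exactly `f x`.
  set G : ℝ → ℂ := fun v => Complex.exp (-Real.pi * 1 * v ^ 2) with hG
  have hGi : Integrable G := by
    have := integrable_cexp_neg_mul_sq (b := (Real.pi : ℂ)) (by simpa using Real.pi_pos)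
    simpa [hG] using this
  have hFG : 𝓕 G = G := by
    rw [hG, fourier_gaussian_pi (b := 1) (by simp)]
    funext t
    simp
  set g : ℝ → ℂ := fun v => f (v + x) - f x * G v with hgdef
  have hfx : Integrable fun v => f (v + x) := hf.comp_add_right x
  have hgi : Integrable g := hfx.sub (hGi.const_mul _)
  have hg0 : g =O[𝓝 0] fun v : ℝ => v := by
    have h1 : (fun v : ℝ => f (v + x) - f x) =O[𝓝 0] fun v : ℝ => v := by
      have ht : Tendsto (fun v : ℝ => v + x) (𝓝 0) (𝓝 x) := by
        have : ContinuousAt (fun v : ℝ => v + x) 0 := by fun_prop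
        simpa [ContinuousAt] using this
      simpa [Function.comp_def] using hx.comp_tendsto ht
    have h2 : (fun v : ℝ => G v - 1) =O[𝓝 0] fun v : ℝ => v := by
      have hd : DifferentiableAt ℝ G 0 := by
        have : DifferentiableAt ℝ (fun v : ℝ => ((v : ℂ))) 0 :=
          Complex.ofRealCLM.differentiableAt
        simp only [hG]
        fun_prop
      simpa [hG] using hd.isBigO_sub
    have h3 := h1.sub (h2.const_mul_left (f x))
    refine h3.congr_left fun v => ?_
    simp only [hgdef]
    ring
  have hA := tendsto_intervalIntegral_fourier_of_isBigO hgi hg0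
  have hFg : ∀ y : ℝ, 𝓕 g y =
      Complex.exp ((2 * Real.pi * x * y : ℝ) * Complex.I) * 𝓕 f y - f x * G y := by
    intro y
    have e1 : 𝓕 g y = 𝓕 (fun v => f (v + x)) y - f x * 𝓕 G y := by
      simp only [Real.fourier_real_eq_integral_exp_smul, smul_eq_mul, hgdef]
      rw [← integral_const_mul, ← integral_sub]
      · congr 1 with v
        ring
      · refine hfx.bdd_mul (c := 1) (by fun_prop) (ae_of_all _ fun v => ?_)
        rw [Complex.norm_exp_ofReal_mul_I]
      · refine Integrable.const_mul (hGi.bdd_mul (c := 1) (by fun_prop) (ae_of_all _ fun v => ?_)) _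
        rw [Complex.norm_exp_ofReal_mul_I]
    have e2 : 𝓕 (fun v => f (v + x)) y =
        Complex.exp ((2 * Real.pi * x * y : ℝ) * Complex.I) * 𝓕 f y := by
      simp only [Real.fourier_real_eq_integral_exp_smul, smul_eq_mul]
      rw [← integral_const_mul, ← integral_add_right_eq_self (fun v =>
        Complex.exp ((2 * Real.pi * x * y : ℝ) * Complex.I) *
          (Complex.exp ((-2 * Real.pi * v * y : ℝ) * Complex.I) * f v)) x]
      congr 1 with v
      rw [← mul_assoc, ← Complex.exp_add]
      congr 2
      push_cast
      ring
    rw [e1, e2, hFG]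
  have hcont : Continuous (𝓕 f) :=
    VectorFourier.fourierIntegral_continuous Real.continuous_fourierChar
      (L := innerₗ ℝ) (by exact continuous_inner) hf
  have hGint : Tendsto (fun R : ℝ => ∫ y in (-R)..R, G y) atTop (𝓝 1) := by
    have h1 := intervalIntegral_tendsto_integral hGi tendsto_neg_atTop_atBot tendsto_id
    have h2 : ∫ y, G y = 1 := by
      have := congrFun hFG 0
      rw [Real.fourier_real_eq_integral_exp_smul] at this
      simpa [hG] using this
    rw [h2] at h1
    exact h1
  have hB := hA.add (hGint.const_mul (f x))
  rw [zero_add, mul_one] at hB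
  refine hB.congr fun R => ?_
  have hGc : Continuous G := by
    simp only [hG]
    fun_prop
  simp_rw [hFg]
  rw [intervalIntegral.integral_sub, intervalIntegral.integral_const_mul, sub_add_cancel]
  · exact Continuous.intervalIntegrable (by fun_prop) _ _
  · exact Continuous.intervalIntegrable (by fun_prop) _ _

open scoped FourierTransform in
/-- The Bromwich inversion formula for the Laplace transform, at a point where the extension by
`0` of the original function is Lipschitz. -/
theorem hasBromwichIntegral_laplace {f : ℝ → ℂ} {c x : ℝ}
    (hf : IntegrableOn (fun v : ℝ => Complex.exp (-(c : ℂ) * v) * f v) (Ioi 0))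
    (hx : (fun v => (Ioi 0).indicator f v - (Ioi 0).indicator f x) =O[𝓝 x] fun v => v - x) :
    HasBromwichIntegral
      (fun θ => Complex.exp (θ * (x : ℂ)) * ∫ v in Ioi (0 : ℝ), Complex.exp (-θ * v) * f v) c
      ((Ioi 0).indicator f x) := by
  set U : ℝ → ℂ := (Ioi 0).indicator f with hU
  -- On the line `Re θ = c` the Laplace transform is the Fourier transform of this damped function
  -- at frequency `y / (2π)`; the damping is undone after inversion by `exp(c x)`.
  set g : ℝ → ℂ := fun v => Complex.exp (-(c : ℂ) * v) * U v with hg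
  have hgi : Integrable g := by
    rw [← integrable_indicator_iff measurableSet_Ioi] at hf
    refine hf.congr (ae_of_all _ fun v => ?_)
    by_cases hv : v ∈ Ioi (0 : ℝ) <;> simp [hg, hU, hv]
  have hgx : (fun v => g v - g x) =O[𝓝 x] fun v => v - x := by
    have hd : DifferentiableAt ℝ (fun v : ℝ => Complex.exp (-(c : ℂ) * v)) x := by
      have : DifferentiableAt ℝ (fun v : ℝ => ((v : ℂ))) x := Complex.ofRealCLM.differentiableAt
      fun_prop
    have h1 : (fun v : ℝ => Complex.exp (-(c : ℂ) * v) * (U v - U x)) =O[𝓝 x]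
        fun v => 1 * (v - x) :=
      Asymptotics.IsBigO.mul (hd.continuousAt.isBigO_one ℝ) hx
    have h2 := hd.isBigO_sub.const_mul_left (U x)
    simp only [one_mul] at h1
    refine (h1.add h2).congr_left fun v => ?_
    simp only [hg]
    ring
  have hmain := tendsto_intervalIntegral_fourier hgi hgx
  have hL : ∀ y : ℝ, ∫ v in Ioi (0 : ℝ), Complex.exp (-((c : ℂ) + (y : ℂ) * Complex.I) * v) * f v =
      𝓕 g (y / (2 * Real.pi)) := by
    intro y
    rw [Real.fourier_real_eq_integral_exp_smul, ← integral_indicator measurableSet_Ioi]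
    congr 1 with v
    by_cases hv : v ∈ Ioi (0 : ℝ)
    · simp only [hg, hU, hv, indicator_of_mem, smul_eq_mul]
      rw [← mul_assoc, ← Complex.exp_add]
      congr 2
      have : (Real.pi : ℂ) ≠ 0 := by exact_mod_cast Real.pi_ne_zero
      push_cast
      field_simp
      ring
    · simp [hg, hU, hv]
  have hpi : (0 : ℝ) < 2 * Real.pi := by positivity
  have hcomp := (hmain.comp (tendsto_id.atTop_div_const hpi)).const_mul
    (Complex.exp ((c : ℂ) * x))
  have hlim : Complex.exp ((c : ℂ) * x) * g x = U x := by
    simp only [hg]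
    rw [← mul_assoc, ← Complex.exp_add]
    simp
  rw [hlim] at hcomp
  refine hcomp.congr fun R => ?_
  have hsub := intervalIntegral.integral_comp_div (a := -R) (b := R)
    (fun y : ℝ => Complex.exp ((2 * Real.pi * x * y : ℝ) * Complex.I) * 𝓕 g y) hpi.ne'
  have hne : (2 * (Real.pi : ℂ)) ≠ 0 := by
    simp [Real.pi_ne_zero]
  simp only [Function.comp_def, id]
  rw [show -(R / (2 * Real.pi)) = -R / (2 * Real.pi) by ring]
  rw [Complex.real_smul] at hsub
  push_cast at hsub ⊢
  rw [← mul_right_inj' hne, mul_left_comm, ← hsub]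
  rw [← intervalIntegral.integral_const_mul, ← intervalIntegral.integral_const_mul,
    ← intervalIntegral.integral_const_mul]
  refine intervalIntegral.integral_congr fun y _ => ?_
  simp only [hL]
  rw [add_mul, Complex.exp_add]
  have hI := Complex.I_ne_zero
  rw [show 2 * (Real.pi : ℂ) * x * (y / (2 * Real.pi)) * Complex.I = y * Complex.I * x by
    field_simp]
  field_simp

/-! ### Chain rule along curves; Laplace transforms of functions of polynomial growth. -/

/-- Chain rule along a plane curve for a function with continuous partial derivatives. -/
theorem hasDerivAt_comp_of_partial {f f₁ f₂ : ℝ → ℝ → ℝ} {a b : ℝ → ℝ} {a' b' s : ℝ}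
    (h₁ : ∀ᶠ v : ℝ × ℝ in 𝓝 (a s, b s), HasDerivAt (fun x => f x v.2) (f₁ v.1 v.2) v.1)
    (h₂ : ∀ᶠ v : ℝ × ℝ in 𝓝 (a s, b s), HasDerivAt (fun y => f v.1 y) (f₂ v.1 v.2) v.2)
    (c₁ : ContinuousAt (fun v : ℝ × ℝ => f₁ v.1 v.2) (a s, b s))
    (c₂ : ContinuousAt (fun v : ℝ × ℝ => f₂ v.1 v.2) (a s, b s))
    (ha : HasDerivAt a a' s) (hb : HasDerivAt b b' s) :
    HasDerivAt (fun s => f (a s) (b s)) (a' * f₁ (a s) (b s) + b' * f₂ (a s) (b s)) s := by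
  let T : ℝ →L[ℝ] (ℝ →L[ℝ] ℝ) := ContinuousLinearMap.mul ℝ ℝ
  have hT : ∀ d : ℝ, T d = ContinuousLinearMap.toSpanSingleton ℝ d := by
    intro d
    ext
    simp [T]
  have key := hasStrictFDerivAt_uncurry_coprod (𝕜 := ℝ) (u := (a s, b s)) (f := f)
    (f₁ := fun x y => T (f₁ x y)) (f₂ := fun x y => T (f₂ x y))
    (by
      filter_upwards [h₁] with v hv
      simpa [Function.HasUncurry.uncurry, hT] using hv.hasFDerivAt)
    (by
      filter_upwards [h₂] with v hv
      simpa [Function.HasUncurry.uncurry, hT] using hv.hasFDerivAt)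
    (T.continuous.continuousAt.comp c₁) (T.continuous.continuousAt.comp c₂)
  have hc := key.hasFDerivAt.comp_hasDerivAt s (ha.prodMk hb)
  convert! hc using 1
  simp [Function.HasUncurry.uncurry, T]
  ring

/-- Half of the exponential decay absorbs the polynomial. These functions dominate the Laplace
integrals below. -/
theorem integrableOn_one_add_pow_mul_exp_neg (m : ℕ) {a : ℝ} (ha : 0 < a) :
    IntegrableOn (fun V : ℝ => (1 + V) ^ m * Real.exp (-a * V)) (Ioi 0) := by
  refine integrable_of_isBigO_exp_neg (b := a / 2) (by positivity) (by fun_prop) ?_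
  have h1 : (fun V : ℝ => (1 + V) ^ m) =O[atTop] fun V => V ^ m := by
    refine Asymptotics.IsBigO.pow ?_ m
    refine Asymptotics.IsBigO.of_bound 2 ?_
    filter_upwards [eventually_ge_atTop 1] with V hV
    rw [Real.norm_of_nonneg (by linarith), Real.norm_of_nonneg (by linarith)]
    linarith
  have h2 : (fun V : ℝ => V ^ m) =O[atTop] fun V => Real.exp (a / 2 * V) :=
    (isLittleO_pow_exp_pos_mul_atTop m (by positivity)).isBigO
  have h3 := (h1.trans h2).mul (Asymptotics.isBigO_refl (fun V : ℝ => Real.exp (-a * V)) atTop)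
  refine h3.congr_right fun V => ?_
  rw [← Real.exp_add]
  ring_nf

/-- Laplace integrand bound for functions of polynomial growth. -/
theorem norm_cexp_mul_le {f : ℝ → ℂ} {C a V : ℝ} {m : ℕ} {θ : ℂ} (hV : 0 < V) (ha : a ≤ θ.re)
    (hf : ‖f V‖ ≤ C * (1 + V) ^ m) :
    ‖Complex.exp (-θ * V) * f V‖ ≤ C * ((1 + V) ^ m * Real.exp (-a * V)) := by
  rw [norm_mul, Complex.norm_exp]
  have h1 : (-θ * (V : ℂ)).re = -θ.re * V := by simp
  rw [h1]
  have h2 : Real.exp (-θ.re * V) ≤ Real.exp (-a * V) := by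
    apply Real.exp_le_exp.2
    nlinarith
  calc Real.exp (-θ.re * V) * ‖f V‖ ≤ Real.exp (-a * V) * (C * (1 + V) ^ m) := by gcongr
    _ = _ := by ring

theorem integrableOn_laplace {f : ℝ → ℂ} {C : ℝ} {m : ℕ} {θ : ℂ} (hθ : 0 < θ.re)
    (hm : AEStronglyMeasurable f (volume.restrict (Ioi 0)))
    (hf : ∀ V, 0 < V → ‖f V‖ ≤ C * (1 + V) ^ m) :
    IntegrableOn (fun V : ℝ => Complex.exp (-θ * V) * f V) (Ioi 0) := by
  refine ((integrableOn_one_add_pow_mul_exp_neg m hθ).const_mul C).mono'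
    ((by fun_prop : Continuous fun V : ℝ => Complex.exp (-θ * V)).aestronglyMeasurable.mul hm) ?_
  filter_upwards [ae_restrict_mem measurableSet_Ioi] with V hV
  exact norm_cexp_mul_le hV le_rfl (hf V hV)

theorem hasDerivAt_laplace {f : ℝ → ℂ} {C : ℝ} {m : ℕ} {θ : ℂ} (hθ : 0 < θ.re)
    (hm : AEStronglyMeasurable f (volume.restrict (Ioi 0)))
    (hf : ∀ V, 0 < V → ‖f V‖ ≤ C * (1 + V) ^ m) :
    HasDerivAt (fun θ : ℂ => ∫ V in Ioi (0 : ℝ), Complex.exp (-θ * V) * f V)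
      (∫ V in Ioi (0 : ℝ), Complex.exp (-θ * V) * (-(V : ℂ) * f V)) θ := by
  -- On this half-plane the decay rate is at least `θ.re / 2`, which gives one dominating function;
  -- the factor `V` from differentiation costs one more power of `1 + V`.
  have hs : {z : ℂ | θ.re / 2 < z.re} ∈ 𝓝 θ :=
    (isOpen_lt continuous_const Complex.continuous_re).mem_nhds (by change θ.re / 2 < θ.re; linarith)
  have hm' : AEStronglyMeasurable (fun V : ℝ => -(V : ℂ) * f V) (volume.restrict (Ioi 0)) :=
    (by fun_prop : Continuous fun V : ℝ => -(V : ℂ)).aestronglyMeasurable.mul hm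
  refine (hasDerivAt_integral_of_dominated_loc_of_deriv_le (μ := volume.restrict (Ioi (0 : ℝ)))
    (F := fun (z : ℂ) (V : ℝ) => Complex.exp (-z * V) * f V)
    (F' := fun (z : ℂ) (V : ℝ) => Complex.exp (-z * V) * (-(V : ℂ) * f V)) hs
    (bound := fun V => C * ((1 + V) ^ (m + 1) * Real.exp (-(θ.re / 2) * V)))
    (Eventually.of_forall fun z =>
      (by fun_prop : Continuous fun V : ℝ => Complex.exp (-z * V)).aestronglyMeasurable.mul hm)
    (integrableOn_laplace hθ hm hf)
    ((by fun_prop : Continuous fun V : ℝ => Complex.exp (-θ * V)).aestronglyMeasurable.mul hm')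
    ?_ ((integrableOn_one_add_pow_mul_exp_neg (m + 1) (by positivity)).const_mul C) ?_).2
  · filter_upwards [ae_restrict_mem measurableSet_Ioi] with V hV z hz
    have hV' : 0 < V := hV
    refine norm_cexp_mul_le (f := fun V : ℝ => -(V : ℂ) * f V) hV (le_of_lt hz) ?_
    rw [norm_mul, norm_neg, Complex.norm_real, Real.norm_of_nonneg hV'.le]
    calc V * ‖f V‖ ≤ (1 + V) * (C * (1 + V) ^ m) := by
          gcongr
          · linarith
          · exact hf V hV
      _ = _ := by ring
  · refine ae_of_all _ fun V z _ => ?_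
    have h1 : HasDerivAt (fun z : ℂ => -z * (V : ℂ)) (-(V : ℂ)) z := by
      simpa using (hasDerivAt_id z).neg.mul_const (V : ℂ)
    convert! (h1.cexp.mul_const (f V)) using 1
    ring

/-- The Laplace transform `∫₀^∞ exp(-θ V) f(V) dV` of a real function at a real point. -/
noncomputable def realLaplace (f : ℝ → ℝ) (θ : ℝ) : ℝ :=
  ∫ V in Ioi (0 : ℝ), Real.exp (-θ * V) * f V

theorem laplace_ofReal (f : ℝ → ℝ) (θ : ℝ) :
    ∫ V in Ioi (0 : ℝ), Complex.exp (-(θ : ℂ) * V) * (f V : ℂ) = (realLaplace f θ : ℂ) := by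
  rw [realLaplace, ← integral_complex_ofReal]
  congr 1 with V
  push_cast
  rfl

theorem integrableOn_realLaplace {f : ℝ → ℝ} {C : ℝ} {m : ℕ} {θ : ℝ} (hθ : 0 < θ)
    (hm : AEStronglyMeasurable f (volume.restrict (Ioi 0)))
    (hf : ∀ V, 0 < V → |f V| ≤ C * (1 + V) ^ m) :
    IntegrableOn (fun V : ℝ => Real.exp (-θ * V) * f V) (Ioi 0) := by
  have := (integrableOn_laplace (f := fun V => (f V : ℂ)) (θ := (θ : ℂ)) (by simpa using hθ)
    (Complex.continuous_ofReal.comp_aestronglyMeasurable hm)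
    (by simpa using hf)).re
  refine this.congr (ae_of_all _ fun V => ?_)
  have e : Complex.exp (-(θ : ℂ) * V) * (f V : ℂ) = ((Real.exp (-θ * V) * f V : ℝ) : ℂ) := by
    push_cast
    rfl
  simp only [e]
  exact Complex.ofReal_re _

theorem hasDerivAt_realLaplace {f : ℝ → ℝ} {C : ℝ} {m : ℕ} {θ : ℝ} (hθ : 0 < θ)
    (hm : AEStronglyMeasurable f (volume.restrict (Ioi 0)))
    (hf : ∀ V, 0 < V → |f V| ≤ C * (1 + V) ^ m) :
    HasDerivAt (realLaplace f) (-realLaplace (fun V => V * f V) θ) θ := by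
  have h := (hasDerivAt_laplace (f := fun V => (f V : ℂ)) (θ := (θ : ℂ)) (by simpa using hθ)
    (Complex.continuous_ofReal.comp_aestronglyMeasurable hm)
    (by simpa using hf)).real_of_complex
  convert! h using 1
  · funext x
    rw [laplace_ofReal, Complex.ofReal_re]
  · have e : ∀ V : ℝ, -(V : ℂ) * (f V : ℂ) = ((-(V * f V) : ℝ) : ℂ) := fun V => by
      push_cast
      ring
    simp_rw [e]
    rw [laplace_ofReal, Complex.ofReal_re, realLaplace, realLaplace, ← integral_neg]
    congr 1 with V
    ring

/-- Joint continuity of the Laplace transform of a continuous family of functions of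
polynomial growth. -/
theorem continuousOn_realLaplace {w : ℝ → ℝ → ℝ} {m : ℕ}
    (hw : ContinuousOn (fun p : ℝ × ℝ => w p.1 p.2) (Ici 0 ×ˢ Ici 0))
    (hb : ∀ T, 0 < T → ∃ C, ∀ t ∈ Icc 0 T, ∀ V, 0 ≤ V → |w V t| ≤ C * (1 + V) ^ m) :
    ContinuousOn (fun p : ℝ × ℝ => realLaplace (fun V => w V p.2) p.1) (Ioi 0 ×ˢ Ici 0) := by
  rintro ⟨θ, t⟩ ⟨hθ, ht⟩
  have hθ' : 0 < θ := hθ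
  have ht' : 0 ≤ t := ht
  obtain ⟨C, hC⟩ := hb (t + 1) (by linarith)
  have hev : ∀ᶠ p : ℝ × ℝ in 𝓝[Ioi 0 ×ˢ Ici 0] (θ, t), θ / 2 < p.1 ∧ 0 ≤ p.2 ∧ p.2 < t + 1 := by
    have h1 : ∀ᶠ p : ℝ × ℝ in 𝓝 (θ, t), θ / 2 < p.1 ∧ p.2 < t + 1 :=
      ((isOpen_lt continuous_const continuous_fst).inter
        (isOpen_lt continuous_snd continuous_const)).mem_nhds
        ⟨by change θ / 2 < θ; linarith, by change t < t + 1; linarith⟩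
    filter_upwards [nhdsWithin_le_nhds h1, self_mem_nhdsWithin] with p hp hp'
    exact ⟨hp.1, hp'.2, hp.2⟩
  refine continuousWithinAt_of_dominated
    (bound := fun V => C * ((1 + V) ^ m * Real.exp (-(θ / 2) * V))) ?_ ?_
    ((integrableOn_one_add_pow_mul_exp_neg m (by positivity)).const_mul C) ?_
  · filter_upwards [hev] with p hp
    refine ContinuousOn.aestronglyMeasurable ?_ measurableSet_Ioi
    refine ContinuousOn.mul (by fun_prop) ?_
    exact hw.comp (by fun_prop : ContinuousOn (fun V : ℝ => (V, p.2)) (Ioi 0))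
      fun V (hV : 0 < V) => ⟨hV.le, hp.2.1⟩
  · filter_upwards [hev] with p hp
    filter_upwards [ae_restrict_mem measurableSet_Ioi] with V hV
    have hV' : 0 < V := hV
    have h1 := hC p.2 ⟨hp.2.1, hp.2.2.le⟩ V hV'.le
    rw [norm_mul, Real.norm_eq_abs, Real.abs_exp, Real.norm_eq_abs]
    calc Real.exp (-p.1 * V) * |w V p.2| ≤ Real.exp (-(θ / 2) * V) * (C * (1 + V) ^ m) := by
          gcongr
          nlinarith [hp.1]
      _ = _ := by ring
  · filter_upwards [ae_restrict_mem measurableSet_Ioi] with V hV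
    have hV' : 0 < V := hV
    refine ContinuousWithinAt.mul (by fun_prop) ?_
    have h1 : ContinuousWithinAt (fun p : ℝ × ℝ => (V, p.2)) (Ioi 0 ×ˢ Ici 0) (θ, t) := by
      fun_prop
    exact ContinuousWithinAt.comp (g := fun p : ℝ × ℝ => w p.1 p.2)
      (f := fun p : ℝ × ℝ => (V, p.2)) (x := (θ, t)) (hw (V, t) ⟨hV'.le, ht⟩) h1
      fun p hp => ⟨hV'.le, hp.2⟩

/-! ### Growth, continuity and boundary values of the shifted price. -/

namespace IsAmericanPutSolution

variable {K ρ : ℝ} {α : ℝ → ℝ} {P : ℝ → ℝ → ℝ}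

theorem continuousOn_shiftedPrice (h : IsAmericanPutSolution K ρ α P) :
    ContinuousOn (fun p : ℝ × ℝ => shiftedPrice K α P p.1 p.2) (Ici 0 ×ˢ Ici 0) := by
  have hα : ContinuousOn (fun p : ℝ × ℝ => α p.2) (Ici 0 ×ˢ Ici 0) :=
    h.boundary_continuousOn.comp continuousOn_snd fun p hp => hp.2
  have hP : ContinuousOn (fun p : ℝ × ℝ => P (p.1 + α p.2) p.2) (Ici 0 ×ˢ Ici 0) := by
    refine h.price_continuousOn.comp
      (f := fun p : ℝ × ℝ => (p.1 + α p.2, p.2)) ((continuousOn_fst.add hα).prodMk continuousOn_snd)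
      fun p hp => ⟨hp.2, ?_⟩
    have : (0 : ℝ) ≤ p.1 := hp.1
    change α p.2 ≤ p.1 + α p.2
    linarith
  exact (hP.sub continuousOn_const).add (continuousOn_fst.add hα)

/-- For large `V` the far-field condition makes `|P| < 1`, so only the term `V + α t - K` grows; the
remaining rectangle is compact. Uniformity in `t` is what later dominations need. -/
theorem exists_abs_shiftedPrice_le (h : IsAmericanPutSolution K ρ α P) {T : ℝ} (hT : 0 < T) :
    ∃ C, ∀ t ∈ Icc 0 T, ∀ V, 0 ≤ V → |shiftedPrice K α P V t| ≤ C * (1 + V) ^ 1 := by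
  have hff := Metric.tendstoUniformlyOn_iff.1 (h.far_field T hT) 1 one_pos
  obtain ⟨M₀, hM₀⟩ := eventually_atTop.1 hff
  set M := max M₀ 0 with hM
  have hcα : ContinuousOn α (Icc 0 T) := h.boundary_continuousOn.mono fun t ht => ht.1
  obtain ⟨A, hA⟩ := isCompact_Icc.exists_bound_of_continuousOn hcα
  have hcomp : IsCompact (Icc (0 : ℝ) M ×ˢ Icc (0 : ℝ) T) := isCompact_Icc.prod isCompact_Icc
  obtain ⟨B, hB⟩ := hcomp.exists_bound_of_continuousOn
    (h.continuousOn_shiftedPrice.mono (prod_mono (fun x hx => hx.1) fun x hx => hx.1))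
  refine ⟨|B| + 1 + |K| + |A| + 1, fun t ht V hV => ?_⟩
  have hA' : |α t| ≤ |A| := (hA t ht).trans (le_abs_self A)
  have hpos : 0 < α t := h.boundary_pos t ht.1
  have hB0 := abs_nonneg B
  have hK0 := abs_nonneg K
  have hA0 := abs_nonneg A
  rw [pow_one]
  rcases le_total V M with hVM | hVM
  · have h1 : |shiftedPrice K α P V t| ≤ |B| :=
      (hB (V, t) ⟨⟨hV, hVM⟩, ht⟩).trans (le_abs_self B)
    nlinarith
  · have h1 : |P (V + α t) t| < 1 := by
      have := hM₀ (V + α t) (by linarith [le_max_left M₀ 0]) t ht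
      simpa [dist_comm, Real.dist_eq] using this
    have h2 : |shiftedPrice K α P V t| ≤ |P (V + α t) t| + |K| + (V + |α t|) := by
      unfold shiftedPrice
      rw [abs_of_pos hpos]
      have e1 := neg_abs_le (P (V + α t) t)
      have e2 := le_abs_self (P (V + α t) t)
      have e3 := neg_abs_le K
      have e4 := le_abs_self K
      rw [abs_le]
      constructor <;> linarith
    nlinarith

theorem shiftedPrice_zero_left (h : IsAmericanPutSolution K ρ α P) {t : ℝ} (ht : 0 ≤ t) :
    shiftedPrice K α P 0 t = 0 := by
  simp [shiftedPrice, h.value_matching t ht]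

theorem shiftedPrice_zero_right (h : IsAmericanPutSolution K ρ α P) {V : ℝ} (hV : 0 ≤ V) :
    shiftedPrice K α P V 0 = V := by
  have h0 := h.boundary_pos 0 le_rfl
  have hK := h.boundary_zero
  unfold shiftedPrice
  rw [h.initial _ (by linarith), hK, max_eq_right (by linarith)]
  ring

end IsAmericanPutSolution

/-! ### The equation on the fixed domain `V > 0` and regularity across the free boundary. -/

/-- `∂P̃/∂V`. -/
noncomputable def shiftedDelta (α : ℝ → ℝ) (P : ℝ → ℝ → ℝ) (V t : ℝ) : ℝ :=
  deriv (fun S => P S t) (V + α t) + 1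

/-- `∂²P̃/∂V²`. -/
noncomputable def shiftedGamma (α : ℝ → ℝ) (P : ℝ → ℝ → ℝ) (V t : ℝ) : ℝ :=
  deriv (deriv fun S => P S t) (V + α t)

/-- `∂P̃/∂t`. -/
noncomputable def shiftedTheta (α : ℝ → ℝ) (P : ℝ → ℝ → ℝ) (V t : ℝ) : ℝ :=
  deriv (fun τ => P (V + α t) τ) t + deriv α t * shiftedDelta α P V t

namespace IsAmericanPutSolution

variable {K ρ : ℝ} {α : ℝ → ℝ} {P : ℝ → ℝ → ℝ}

theorem hasDerivAt_boundary (h : IsAmericanPutSolution K ρ α P) {t : ℝ} (ht : 0 < t) :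
    HasDerivAt α (deriv α t) t :=
  ((h.boundary_contDiffOn.differentiableOn (by norm_num)).differentiableAt
    (Ioi_mem_nhds ht)).hasDerivAt

theorem continuousOn_deriv_boundary (h : IsAmericanPutSolution K ρ α P) :
    ContinuousOn (deriv α) (Ioi 0) :=
  h.boundary_contDiffOn.continuousOn_deriv_of_isOpen isOpen_Ioi le_rfl

theorem hasDerivAt_shiftedPrice_left (h : IsAmericanPutSolution K ρ α P) {t V : ℝ} (ht : 0 < t)
    (hV : 0 < V) :
    HasDerivAt (fun V => shiftedPrice K α P V t) (shiftedDelta α P V t) V := by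
  have h1 := (h.differentiableAt_S t ht (V + α t) (by linarith)).hasDerivAt
  have h2 := h1.comp_add_const V (α t)
  exact (h2.sub_const K).add ((hasDerivAt_id V).add_const (α t))

theorem hasDerivAt_shiftedDelta (h : IsAmericanPutSolution K ρ α P) {t V : ℝ} (ht : 0 < t)
    (hV : 0 < V) :
    HasDerivAt (fun V => shiftedDelta α P V t) (shiftedGamma α P V t) V := by
  have h1 := (h.differentiableAt_SS t ht (V + α t) (by linarith)).hasDerivAt
  exact (h1.comp_add_const V (α t)).add_const 1

/-- Openness of the continuation region, which turns the hypotheses there into statements on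
neighbourhoods, as the chain rule requires. -/
theorem eventually_boundary_lt (h : IsAmericanPutSolution K ρ α P) {t S : ℝ} (ht : 0 < t)
    (hS : α t < S) : ∀ᶠ p : ℝ × ℝ in 𝓝 (S, t), 0 < p.2 ∧ α p.2 < p.1 := by
  have h0 : ∀ᶠ p : ℝ × ℝ in 𝓝 (S, t), 0 < p.2 :=
    continuousAt_snd.eventually (lt_mem_nhds ht)
  have hα : ContinuousAt (fun p : ℝ × ℝ => α p.2) (S, t) :=
    ContinuousAt.comp (f := Prod.snd) (x := (S, t))
      (h.hasDerivAt_boundary ht).continuousAt continuousAt_snd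
  exact h0.and (hα.eventually_lt continuousAt_fst hS)

theorem hasDerivAt_shiftedPrice_right (h : IsAmericanPutSolution K ρ α P) {t V : ℝ} (ht : 0 < t)
    (hV : 0 < V) :
    HasDerivAt (fun t => shiftedPrice K α P V t) (shiftedTheta α P V t) t := by
  have hα := h.hasDerivAt_boundary ht
  have hev := h.eventually_boundary_lt (S := V + α t) ht (by linarith)
  have hc := hasDerivAt_comp_of_partial (f := P) (a := fun t => V + α t) (b := fun t => t) (s := t)
    (f₁ := fun x y => deriv (fun S => P S y) x) (f₂ := fun x y => deriv (fun τ => P x τ) y)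
    (by
      filter_upwards [hev] with p hp
      exact (h.differentiableAt_S p.2 hp.1 p.1 hp.2).hasDerivAt)
    (by
      filter_upwards [hev] with p hp
      exact (h.differentiableAt_t p.2 hp.1 p.1 hp.2).hasDerivAt)
    (h.deriv_S_continuousOn.continuousAt
      (by filter_upwards [hev] with p hp using ⟨hp.1, hp.2.le⟩))
    (h.deriv_t_continuousOn.continuousAt hev)
    (hα.const_add V) (hasDerivAt_id t)
  have h2 := (hc.sub_const K).add (hα.const_add V)
  convert! h2 using 1
  simp only [shiftedTheta, shiftedDelta]
  ring

/-- `S` is a stationary solution of the pricing equation, so removing the payoff `K - S` leaves only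
the source `-ρK`; the moving frame adds the drift `α'`. -/
theorem shiftedTheta_eq (h : IsAmericanPutSolution K ρ α P) {t V : ℝ} (ht : 0 < t) (hV : 0 < V) :
    shiftedTheta α P V t = (V + α t) * shiftedGamma α P V t +
      (ρ * (V + α t) + deriv α t) * shiftedDelta α P V t - ρ * shiftedPrice K α P V t - ρ * K := by
  unfold shiftedTheta shiftedDelta shiftedGamma shiftedPrice
  rw [h.pde t ht (V + α t) (by linarith)]
  ring

theorem continuousOn_shift (h : IsAmericanPutSolution K ρ α P) {s : Set (ℝ × ℝ)}
    (hs : ∀ p ∈ s, 0 < p.2) :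
    ContinuousOn (fun p : ℝ × ℝ => (p.1 + α p.2, p.2)) s := by
  have hα : ContinuousOn (fun p : ℝ × ℝ => α p.2) s :=
    h.boundary_continuousOn.comp continuousOn_snd fun p hp => (hs p hp).le
  exact (continuousOn_fst.add hα).prodMk continuousOn_snd

theorem continuousOn_shiftedDelta (h : IsAmericanPutSolution K ρ α P) :
    ContinuousOn (fun p : ℝ × ℝ => shiftedDelta α P p.1 p.2) (Ici 0 ×ˢ Ioi 0) := by
  refine ContinuousOn.add ?_ continuousOn_const
  refine h.deriv_S_continuousOn.comp (h.continuousOn_shift fun p hp => hp.2) fun p hp => ⟨hp.2, ?_⟩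
  have : (0 : ℝ) ≤ p.1 := hp.1
  change α p.2 ≤ p.1 + α p.2
  linarith

theorem continuousOn_shiftedTheta (h : IsAmericanPutSolution K ρ α P) :
    ContinuousOn (fun p : ℝ × ℝ => shiftedTheta α P p.1 p.2) (Ioi 0 ×ˢ Ioi 0) := by
  refine ContinuousOn.add ?_ (ContinuousOn.mul ?_ ?_)
  · refine h.deriv_t_continuousOn.comp (h.continuousOn_shift fun p hp => hp.2)
      fun p hp => ⟨hp.2, ?_⟩
    have : (0 : ℝ) < p.1 := hp.1
    change α p.2 < p.1 + α p.2
    linarith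
  · exact h.continuousOn_deriv_boundary.comp continuousOn_snd fun p hp => hp.2
  · exact h.continuousOn_shiftedDelta.mono (prod_mono Ioi_subset_Ici_self subset_rfl)

/-- Smooth pasting in shifted variables; with value matching it removes the boundary terms at `V =
0`. -/
theorem shiftedDelta_zero_left (h : IsAmericanPutSolution K ρ α P) {t : ℝ} (ht : 0 < t) :
    shiftedDelta α P 0 t = 0 := by
  simp [shiftedDelta, (h.smooth_pasting t ht).deriv]

theorem aestronglyMeasurable_shiftedPrice (h : IsAmericanPutSolution K ρ α P) {t : ℝ}
    (ht : 0 ≤ t) :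
    AEStronglyMeasurable (fun V => shiftedPrice K α P V t) (volume.restrict (Ioi 0)) := by
  refine ContinuousOn.aestronglyMeasurable ?_ measurableSet_Ioi
  exact h.continuousOn_shiftedPrice.comp (by fun_prop : ContinuousOn (fun V : ℝ => (V, t)) (Ioi 0))
    fun V (hV : 0 < V) => ⟨hV.le, ht⟩

theorem exists_abs_shiftedPrice_le_at (h : IsAmericanPutSolution K ρ α P) {t : ℝ} (ht : 0 ≤ t) :
    ∃ C, ∀ V, 0 ≤ V → |shiftedPrice K α P V t| ≤ C * (1 + V) ^ 1 := by
  obtain ⟨C, hC⟩ := h.exists_abs_shiftedPrice_le (T := t + 1) (by linarith)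
  exact ⟨C, hC t ⟨ht, by linarith⟩⟩

/-- The price minus the payoff is Lipschitz at each point, across the free boundary. -/
theorem indicator_shiftedPrice_sub_isBigO (h : IsAmericanPutSolution K ρ α P) {t S : ℝ}
    (ht : 0 ≤ t) (hS : 0 < S) :
    (fun V => (Ioi 0).indicator (fun V => (shiftedPrice K α P V t : ℂ)) V -
      (Ioi 0).indicator (fun V => (shiftedPrice K α P V t : ℂ)) (S - α t))
      =O[𝓝 (S - α t)] fun V => V - (S - α t) := by
  have hind : ∀ V, 0 < V + α t → (Ioi 0).indicator (fun V => (shiftedPrice K α P V t : ℂ)) V =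
      (shiftedPrice K α P V t : ℂ) := by
    intro V hV
    rcases lt_trichotomy 0 V with hV0 | rfl | hV0
    · simp [hV0]
    · simp [h.shiftedPrice_zero_left ht]
    · have : V ∉ Ioi (0 : ℝ) := not_lt.2 hV0.le
      rw [indicator_of_notMem this, shiftedPrice, h.exercise t ht _ hV (by linarith)]
      simp
  have hev : ∀ᶠ V in 𝓝 (S - α t), 0 < V + α t := by
    have : ContinuousAt (fun V => V + α t) (S - α t) := by fun_prop
    exact this.eventually (lt_mem_nhds (by linarith))
  -- At `t = 0` there is no smooth pasting: the extension is `max V 0`, which has a kink but is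
  -- Lipschitz. For `t > 0` smooth pasting makes the price differentiable at the boundary too.
  rcases ht.eq_or_lt with rfl | ht0
  · refine Asymptotics.IsBigO.of_bound 1 ?_
    have hmax : ∀ V, (Ioi 0).indicator (fun V => (shiftedPrice K α P V 0 : ℂ)) V =
        ((max V 0 : ℝ) : ℂ) := by
      intro V
      by_cases hV : 0 < V
      · rw [indicator_of_mem (mem_Ioi.2 hV), h.shiftedPrice_zero_right hV.le,
          max_eq_left hV.le]
      · rw [indicator_of_notMem (by simpa using hV), max_eq_right (not_lt.1 hV)]
        simp
    refine Eventually.of_forall fun V => ?_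
    rw [hmax, hmax, ← Complex.ofReal_sub, Complex.norm_real, one_mul]
    exact abs_max_sub_max_le_abs _ _ _
  · have hd : DifferentiableAt ℝ (fun V => shiftedPrice K α P V t) (S - α t) := by
      have hP : DifferentiableAt ℝ (fun x => P x t) S := by
        rcases lt_trichotomy (α t) S with hlt | heq | hgt
        · exact h.differentiableAt_S t ht0 S hlt
        · rw [← heq]
          exact (h.smooth_pasting t ht0).differentiableAt
        · have : (fun x => P x t) =ᶠ[𝓝 S] fun x => K - x := by
            filter_upwards [Ioo_mem_nhds hS hgt] with x hx using h.exercise t ht x hx.1 hx.2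
          exact DifferentiableAt.congr_of_eventuallyEq (by fun_prop) this
      have hc : DifferentiableAt ℝ (fun V => P (V + α t) t) (S - α t) := by
        refine DifferentiableAt.comp (g := fun x => P x t) (S - α t) ?_ (by fun_prop)
        simpa using hP
      exact (hc.sub_const K).add (differentiableAt_id.add_const (α t))
    have hO := hd.isBigO_sub
    have h1 : (fun V => ((shiftedPrice K α P V t - shiftedPrice K α P (S - α t) t : ℝ) : ℂ))
        =O[𝓝 (S - α t)] fun V => V - (S - α t) := by
      refine Asymptotics.IsBigO.trans (Asymptotics.isBigO_of_le _ fun V => ?_) hO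
      rw [Complex.norm_real]
    refine h1.congr' ?_ EventuallyEq.rfl
    filter_upwards [hev] with V hV
    rw [hind V hV, hind (S - α t) (by linarith)]
    push_cast
    ring

/-- In the exercise region the price equals the payoff, so extension by `0` is the correct value
there and one inversion formula covers all `S > 0`. -/
theorem indicator_shiftedPrice_eq (h : IsAmericanPutSolution K ρ α P) {t S : ℝ}
    (ht : 0 ≤ t) (hS : 0 < S) :
    (Ioi 0).indicator (fun V => (shiftedPrice K α P V t : ℂ)) (S - α t) = P S t - K + S := by
  rcases lt_trichotomy (α t) S with hlt | heq | hgt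
  · rw [indicator_of_mem (by simpa using hlt)]
    simp [shiftedPrice]
  · rw [← heq, h.value_matching t ht]
    simp
  · rw [indicator_of_notMem (by simpa using hgt.le), h.exercise t ht S hS hgt]
    simp

end IsAmericanPutSolution

/-! ### Truncated Laplace kernels: bounds and limits. -/

/-- Differentiation under the integral sign on a compact interval, for an integrand with
continuous time derivative. -/
theorem hasDerivAt_intervalIntegral_of_continuousOn {f f' : ℝ → ℝ → ℝ} {a b t r : ℝ} (hab : a ≤ b)
    (hr : 0 < r) (hf : ContinuousOn (fun p : ℝ × ℝ => f p.1 p.2) (Icc a b ×ˢ Icc (t - r) (t + r)))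
    (hf' : ContinuousOn (fun p : ℝ × ℝ => f' p.1 p.2) (Icc a b ×ˢ Icc (t - r) (t + r)))
    (hd : ∀ V ∈ Icc a b, ∀ s ∈ Icc (t - r) (t + r), HasDerivAt (fun s => f V s) (f' V s) s) :
    HasDerivAt (fun s => ∫ V in a..b, f V s) (∫ V in a..b, f' V t) t := by
  have hsec : ∀ {g : ℝ → ℝ → ℝ},
      ContinuousOn (fun p : ℝ × ℝ => g p.1 p.2) (Icc a b ×ˢ Icc (t - r) (t + r)) →
      ∀ s ∈ Icc (t - r) (t + r), ContinuousOn (fun V => g V s) (uIcc a b) := by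
    intro g hg s hs
    rw [uIcc_of_le hab]
    exact hg.comp (by fun_prop : ContinuousOn (fun V : ℝ => (V, s)) (Icc a b))
      fun V hV => ⟨hV, hs⟩
  have hmem : t ∈ Icc (t - r) (t + r) := ⟨by linarith, by linarith⟩
  have hnhds : Icc (t - r) (t + r) ∈ 𝓝 t := Icc_mem_nhds (by linarith) (by linarith)
  obtain ⟨B, hB⟩ := (isCompact_Icc.prod isCompact_Icc).exists_bound_of_continuousOn hf'
  have hsub : uIoc a b ⊆ Icc a b := by
    rw [uIoc_of_le hab]
    exact Ioc_subset_Icc_self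
  refine (intervalIntegral.hasDerivAt_integral_of_dominated_loc_of_deriv_le (F := fun s V => f V s)
    (F' := fun s V => f' V s) (bound := fun _ => B) hnhds ?_ (hsec hf t hmem).intervalIntegrable
    ?_ ?_ (by simp) ?_).2
  · filter_upwards [hnhds] with s hs
    exact ((hsec hf s hs).intervalIntegrable (μ := volume)).aestronglyMeasurable_restrict_uIoc
  · exact ((hsec hf' t hmem).intervalIntegrable (μ := volume)).aestronglyMeasurable_restrict_uIoc
  · exact ae_of_all _ fun V hV s hs => hB (V, s) ⟨hsub hV, hs⟩
  · exact ae_of_all _ fun V hV s hs => hd V (hsub hV) s hs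

/-- The Laplace kernel `exp(-θ V)`, truncated at `V = 1 / m` so that it vanishes there to second
order. -/
noncomputable def truncKernel (θ m V : ℝ) : ℝ := Real.exp (-θ * V) * (1 - m * V) ^ 2

noncomputable def truncKernelDeriv (θ m V : ℝ) : ℝ :=
  Real.exp (-θ * V) * (-θ * (1 - m * V) ^ 2 - 2 * m * (1 - m * V))

noncomputable def truncKernelDeriv₂ (θ m V : ℝ) : ℝ :=
  Real.exp (-θ * V) * (θ ^ 2 * (1 - m * V) ^ 2 + 4 * θ * m * (1 - m * V) + 2 * m ^ 2)

/-- The formal adjoint of `(V + a) ∂² + (ρ (V + a) + b) ∂ - ρ`, applied to `truncKernel`. -/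
noncomputable def truncAdjoint (ρ a b θ m V : ℝ) : ℝ :=
  2 * truncKernelDeriv θ m V + (V + a) * truncKernelDeriv₂ θ m V -
    truncKernelDeriv θ m V * (ρ * (V + a) + b) - 2 * ρ * truncKernel θ m V

theorem hasDerivAt_exp_neg_mul (θ V : ℝ) :
    HasDerivAt (fun V => Real.exp (-θ * V)) (Real.exp (-θ * V) * -θ) V := by
  have h : HasDerivAt (fun V => -θ * V) (-θ) V := by simpa using (hasDerivAt_id V).const_mul (-θ)
  exact h.exp

theorem hasDerivAt_truncKernel (θ m V : ℝ) :
    HasDerivAt (truncKernel θ m) (truncKernelDeriv θ m V) V := by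
  have h1 : HasDerivAt (fun V => 1 - m * V) (-m) V := by
    simpa using ((hasDerivAt_id V).const_mul m).const_sub 1
  convert! (hasDerivAt_exp_neg_mul θ V).mul (h1.pow 2) using 1
  simp only [truncKernelDeriv]
  simp
  ring

theorem hasDerivAt_truncKernelDeriv (θ m V : ℝ) :
    HasDerivAt (truncKernelDeriv θ m) (truncKernelDeriv₂ θ m V) V := by
  have h1 : HasDerivAt (fun V => 1 - m * V) (-m) V := by
    simpa using ((hasDerivAt_id V).const_mul m).const_sub 1
  convert! (hasDerivAt_exp_neg_mul θ V).mul
    (((h1.pow 2).const_mul (-θ)).sub (h1.const_mul (2 * m))) using 1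
  simp only [truncKernelDeriv₂]
  simp
  ring

/-- On the support `m V ≤ 1` both `m` and `1 - m V` lie in `[0, 1]`, so the bounds do not depend on
`m` and survive `m → 0`. -/
theorem truncKernel_bounds {θ m V : ℝ} (hθ : 0 < θ) (hm : 0 ≤ m) (hm1 : m ≤ 1) (hV : 0 ≤ V)
    (hmV : m * V ≤ 1) :
    |truncKernel θ m V| ≤ Real.exp (-θ * V) ∧
    |truncKernelDeriv θ m V| ≤ Real.exp (-θ * V) * (θ + 2) ∧
    |truncKernelDeriv₂ θ m V| ≤ Real.exp (-θ * V) * (θ + 2) ^ 2 := by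
  have hmV0 : 0 ≤ m * V := by positivity
  set x := 1 - m * V with hx
  have hx0 : 0 ≤ x := by linarith
  have hx1 : x ≤ 1 := by linarith
  have hx2 : x ^ 2 ≤ 1 := pow_le_one₀ hx0 hx1
  have hmx : m * x ≤ 1 := mul_le_one₀ hm1 hx0 hx1
  have hmx0 : 0 ≤ m * x := by positivity
  have hm2 : m ^ 2 ≤ 1 := pow_le_one₀ hm hm1
  refine ⟨?_, ?_, ?_⟩
  · rw [truncKernel, abs_mul, Real.abs_exp, abs_of_nonneg (sq_nonneg _)]
    exact mul_le_of_le_one_right (Real.exp_pos _).le hx2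
  · rw [truncKernelDeriv, abs_mul, Real.abs_exp]
    gcongr
    rw [abs_le, ← hx]
    have : θ * x ^ 2 ≤ θ := mul_le_of_le_one_right hθ.le hx2
    have : 0 ≤ θ * x ^ 2 := by positivity
    constructor <;> linarith
  · rw [truncKernelDeriv₂, abs_mul, Real.abs_exp]
    gcongr
    rw [← hx, abs_of_nonneg (by positivity)]
    have : θ ^ 2 * x ^ 2 ≤ θ ^ 2 := mul_le_of_le_one_right (by positivity) hx2
    have : θ * (m * x) ≤ θ := mul_le_of_le_one_right hθ.le hmx
    linarith

theorem abs_truncAdjoint_le {ρ a b a₁ b₁ θ m V : ℝ} (hρ : 0 < ρ) (hθ : 0 < θ) (hm : 0 ≤ m)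
    (hm1 : m ≤ 1) (hV : 0 ≤ V) (hmV : m * V ≤ 1) (ha : |a| ≤ a₁) (hb : |b| ≤ b₁) :
    |truncAdjoint ρ a b θ m V| ≤ (2 * (θ + 2) + (1 + a₁) * (θ + 2) ^ 2 +
      (θ + 2) * (ρ * (1 + a₁) + b₁) + 2 * ρ) * (1 + V) * Real.exp (-θ * V) := by
  obtain ⟨h0, h1, h2⟩ := truncKernel_bounds hθ hm hm1 hV hmV
  set e := Real.exp (-θ * V) with he
  have he0 : 0 < e := Real.exp_pos _
  have ha0 : 0 ≤ a₁ := (abs_nonneg a).trans ha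
  have hb0 : 0 ≤ b₁ := (abs_nonneg b).trans hb
  have hVa : |V + a| ≤ (1 + a₁) * (1 + V) := by
    have := abs_add_le V a
    rw [abs_of_nonneg hV] at this
    nlinarith
  have hl : |ρ * (V + a) + b| ≤ (ρ * (1 + a₁) + b₁) * (1 + V) := by
    have h3 := abs_add_le (ρ * (V + a)) b
    rw [abs_mul, abs_of_pos hρ] at h3
    have h4 : ρ * |V + a| ≤ ρ * ((1 + a₁) * (1 + V)) := by gcongr
    nlinarith
  have t1 : |2 * truncKernelDeriv θ m V| ≤ 2 * (e * (θ + 2)) * (1 + V) := by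
    rw [abs_mul, abs_two]
    have : 0 ≤ 2 * (e * (θ + 2)) * V := by positivity
    linarith
  have t2 : |(V + a) * truncKernelDeriv₂ θ m V| ≤ (1 + a₁) * (1 + V) * (e * (θ + 2) ^ 2) := by
    rw [abs_mul]
    gcongr
  have t3 : |truncKernelDeriv θ m V * (ρ * (V + a) + b)| ≤
      e * (θ + 2) * ((ρ * (1 + a₁) + b₁) * (1 + V)) := by
    rw [abs_mul]
    gcongr
  have t4 : |2 * ρ * truncKernel θ m V| ≤ 2 * ρ * e * (1 + V) := by
    rw [abs_mul, abs_of_pos (by positivity : 0 < 2 * ρ)]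
    have : 2 * ρ * |truncKernel θ m V| ≤ 2 * ρ * e := by gcongr
    have : 0 ≤ 2 * ρ * e * V := by positivity
    linarith
  rw [truncAdjoint]
  calc _ ≤ |2 * truncKernelDeriv θ m V + (V + a) * truncKernelDeriv₂ θ m V| +
        |truncKernelDeriv θ m V * (ρ * (V + a) + b)| + |2 * ρ * truncKernel θ m V| :=
        (abs_sub _ _).trans (add_le_add_left (abs_sub _ _) _)
    _ ≤ 2 * (e * (θ + 2)) * (1 + V) + (1 + a₁) * (1 + V) * (e * (θ + 2) ^ 2) +
        e * (θ + 2) * ((ρ * (1 + a₁) + b₁) * (1 + V)) + 2 * ρ * e * (1 + V) := by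
        gcongr
        exact (abs_add_le _ _).trans (add_le_add t1 t2)
    _ = _ := by ring

theorem truncKernel_zero (θ V : ℝ) : truncKernel θ 0 V = Real.exp (-θ * V) := by
  simp [truncKernel]

/-- Without truncation the adjoint multiplies the exponential by an affine function of `V`. The
factor `V` becomes `-∂/∂θ` after integration, which is why the transformed equation is of first
order. -/
theorem truncAdjoint_zero (ρ a b θ V : ℝ) :
    truncAdjoint ρ a b θ 0 V = Real.exp (-θ * V) *
      ((θ ^ 2 + ρ * θ) * V + (a * θ ^ 2 - 2 * θ + ρ * a * θ + b * θ - 2 * ρ)) := by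
  simp only [truncAdjoint, truncKernel, truncKernelDeriv, truncKernelDeriv₂]
  ring

theorem continuous_truncKernel_left (θ V : ℝ) : Continuous fun m => truncKernel θ m V := by
  unfold truncKernel
  fun_prop

theorem continuous_truncAdjoint_left (ρ a b θ V : ℝ) :
    Continuous fun m => truncAdjoint ρ a b θ m V := by
  unfold truncAdjoint truncKernel truncKernelDeriv truncKernelDeriv₂
  fun_prop

theorem continuous_truncKernel (θ m : ℝ) : Continuous (truncKernel θ m) := by
  unfold truncKernel
  fun_prop

theorem continuous_truncAdjoint (ρ a b θ m : ℝ) : Continuous (truncAdjoint ρ a b θ m) := by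
  unfold truncAdjoint truncKernel truncKernelDeriv truncKernelDeriv₂
  fun_prop

/-- Dominated convergence for integrals over `[m, 1 / m]` as `m → 0+`. -/
theorem tendsto_intervalIntegral_inv {g : ℝ → ℝ → ℝ} {B : ℝ → ℝ}
    (hg : ∀ m, 0 < m → m < 1 → ContinuousOn (g m) (Ioi 0)) (hB : IntegrableOn B (Ioi 0))
    (hb : ∀ m, 0 < m → m < 1 → ∀ V, 0 < V → m * V ≤ 1 → |g m V| ≤ B V)
    {g₀ : ℝ → ℝ} (hlim : ∀ V, 0 < V → Tendsto (fun m => g m V) (𝓝[>] 0) (𝓝 (g₀ V))) :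
    Tendsto (fun m : ℝ => ∫ V in m..m⁻¹, g m V) (𝓝[>] 0) (𝓝 (∫ V in Ioi 0, g₀ V)) := by
  have h1 : ∀ᶠ m : ℝ in 𝓝[>] 0, 0 < m ∧ m < 1 := Ioo_mem_nhdsGT one_pos
  have heq : ∀ᶠ m : ℝ in 𝓝[>] 0, ∫ V in Ioi 0, (Ioc m m⁻¹).indicator (g m) V =
      ∫ V in m..m⁻¹, g m V := by
    filter_upwards [h1] with m hm
    have hmi : m ≤ m⁻¹ := hm.2.le.trans (one_le_inv₀ hm.1 |>.2 hm.2.le)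
    have hsub : Ioc m m⁻¹ ⊆ Ioi 0 := fun V hV => hm.1.trans hV.1
    rw [intervalIntegral.integral_of_le hmi, setIntegral_indicator measurableSet_Ioc,
      inter_eq_right.2 hsub]
  refine Tendsto.congr' heq ?_
  have hBnn : ∀ m, 0 < m → m < 1 → ∀ V, 0 < V →
      ‖(Ioc m m⁻¹).indicator (g m) V‖ ≤ |B V| := by
    intro m hm hm1 V hV
    by_cases hmem : V ∈ Ioc m m⁻¹
    · rw [indicator_of_mem hmem]
      refine (hb m hm hm1 V hV ?_).trans (le_abs_self _)
      calc m * V ≤ m * m⁻¹ := by gcongr; exact hmem.2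
        _ = 1 := mul_inv_cancel₀ hm.ne'
    · rw [indicator_of_notMem hmem]
      simp
  refine tendsto_integral_filter_of_dominated_convergence (fun V => |B V|) ?_ ?_ hB.abs ?_
  · filter_upwards [h1] with m hm
    exact ((hg m hm.1 hm.2).aestronglyMeasurable measurableSet_Ioi).indicator measurableSet_Ioc
  · filter_upwards [h1] with m hm
    filter_upwards [ae_restrict_mem measurableSet_Ioi] with V hV using hBnn m hm.1 hm.2 V hV
  · filter_upwards [ae_restrict_mem measurableSet_Ioi] with V hV
    have hV' : 0 < V := hV
    refine (hlim V hV).congr' ?_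
    filter_upwards [h1, Ioo_mem_nhdsGT hV', Ioo_mem_nhdsGT (inv_pos.2 hV')] with m hm hmV hmV'
    have : V ∈ Ioc m m⁻¹ := ⟨hmV.2, (le_inv_comm₀ hm.1 hV').1 hmV'.2.le⟩
    rw [indicator_of_mem this]

theorem abs_intervalIntegral_inv_le {g B : ℝ → ℝ} {m : ℝ} (hm : 0 < m) (hm1 : m < 1)
    (hB : IntegrableOn B (Ioi 0)) (hB0 : ∀ V, 0 < V → 0 ≤ B V)
    (hb : ∀ V, 0 < V → m * V ≤ 1 → |g V| ≤ B V) :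
    |∫ V in m..m⁻¹, g V| ≤ ∫ V in Ioi 0, B V := by
  have hmi : m ≤ m⁻¹ := hm1.le.trans (one_le_inv₀ hm |>.2 hm1.le)
  have hsub : Ioc m m⁻¹ ⊆ Ioi 0 := fun V hV => hm.trans hV.1
  rw [intervalIntegral.integral_of_le hmi]
  calc |∫ V in Ioc m m⁻¹, g V| ≤ ∫ V in Ioc m m⁻¹, B V := by
        rw [← Real.norm_eq_abs]
        refine norm_integral_le_of_norm_le (hB.mono_set hsub) ?_
        filter_upwards [ae_restrict_mem measurableSet_Ioc] with V hV
        refine hb V (hsub hV) ?_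
        calc m * V ≤ m * m⁻¹ := by gcongr; exact hV.2
          _ = 1 := mul_inv_cancel₀ hm.ne'
    _ ≤ ∫ V in Ioi 0, B V := by
        refine setIntegral_mono_set hB ?_ hsub.eventuallyLE
        filter_upwards [ae_restrict_mem measurableSet_Ioi] with V hV using hB0 V hV

/-! ### The transformed equation: time derivative of the Laplace transform. -/

namespace IsAmericanPutSolution

variable {K ρ : ℝ} {α : ℝ → ℝ} {P : ℝ → ℝ → ℝ}

/-- Integration by parts in the equation tested against the truncated Laplace kernel. -/
theorem integral_truncKernel_mul_shiftedTheta (h : IsAmericanPutSolution K ρ α P) {θ m t : ℝ}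
    (ht : 0 < t) (hm : 0 < m) (hm1 : m < 1) :
    ∫ V in m..m⁻¹, truncKernel θ m V * shiftedTheta α P V t =
      (∫ V in m..m⁻¹, (shiftedPrice K α P V t * truncAdjoint ρ (α t) (deriv α t) θ m V -
        ρ * K * truncKernel θ m V)) -
      (truncKernel θ m m * (m + α t) * shiftedDelta α P m t -
        (truncKernel θ m m + (m + α t) * truncKernelDeriv θ m m) * shiftedPrice K α P m t +
        truncKernel θ m m * (ρ * (m + α t) + deriv α t) * shiftedPrice K α P m t) := by
  have hmi : m ≤ m⁻¹ := hm1.le.trans (one_le_inv₀ hm |>.2 hm1.le)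
  have hsub : uIcc m m⁻¹ ⊆ Ioi 0 := by
    rw [uIcc_of_le hmi]
    exact fun V hV => hm.trans_le hV.1
  have hw : ContinuousOn (fun V => shiftedPrice K α P V t) (uIcc m m⁻¹) := fun V hV =>
    (h.hasDerivAt_shiftedPrice_left ht (hsub hV)).continuousAt.continuousWithinAt
  have hwt : ContinuousOn (fun V => shiftedTheta α P V t) (uIcc m m⁻¹) :=
    h.continuousOn_shiftedTheta.comp
      (by fun_prop : ContinuousOn (fun V : ℝ => (V, t)) (uIcc m m⁻¹)) fun V hV => ⟨hsub hV, ht⟩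
  have hc1 : ContinuousOn (fun V => truncKernel θ m V * shiftedTheta α P V t) (uIcc m m⁻¹) :=
    (continuous_truncKernel θ m).continuousOn.mul hwt
  have hc2 : ContinuousOn (fun V => shiftedPrice K α P V t *
      truncAdjoint ρ (α t) (deriv α t) θ m V - ρ * K * truncKernel θ m V) (uIcc m m⁻¹) :=
    (hw.mul (continuous_truncAdjoint _ _ _ _ _).continuousOn).sub
      (continuousOn_const.mul (continuous_truncKernel θ m).continuousOn)
  -- Lagrange's identity: the antiderivative is the bilinear boundary form of the operator and its
  -- adjoint, so both integrations by parts are done at once.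
  have key := intervalIntegral.integral_eq_sub_of_hasDerivAt (a := m) (b := m⁻¹)
    (f := fun V => truncKernel θ m V * (V + α t) * shiftedDelta α P V t -
        (truncKernel θ m V + (V + α t) * truncKernelDeriv θ m V) * shiftedPrice K α P V t +
        truncKernel θ m V * (ρ * (V + α t) + deriv α t) * shiftedPrice K α P V t)
    (f' := fun V => truncKernel θ m V * shiftedTheta α P V t -
      (shiftedPrice K α P V t * truncAdjoint ρ (α t) (deriv α t) θ m V -
        ρ * K * truncKernel θ m V))
    (fun V hV => by
      have d0 := hasDerivAt_truncKernel θ m V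
      have d1 := hasDerivAt_truncKernelDeriv θ m V
      have d2 := h.hasDerivAt_shiftedPrice_left ht (hsub hV)
      have d3 := h.hasDerivAt_shiftedDelta ht (hsub hV)
      have d4 : HasDerivAt (fun V => V + α t) 1 V := (hasDerivAt_id V).add_const _
      have d5 : HasDerivAt (fun V => ρ * (V + α t) + deriv α t) ρ V := by
        simpa using (d4.const_mul ρ).add_const (deriv α t)
      convert! (((d0.mul d4).mul d3).sub ((d0.add (d4.mul d1)).mul d2)).add
        ((d0.mul d5).mul d2) using 1
      simp only [truncAdjoint, Pi.mul_apply, Pi.add_apply]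
      rw [h.shiftedTheta_eq ht (hsub hV)]
      ring)
    (hc1.sub hc2).intervalIntegrable
  rw [intervalIntegral.integral_sub hc1.intervalIntegrable hc2.intervalIntegrable] at key
  -- The double zero at `1/m` removes every term at the upper end, so nothing about `P_S` at
  -- infinity is used.
  have hz : truncKernel θ m m⁻¹ = 0 ∧ truncKernelDeriv θ m m⁻¹ = 0 := by
    simp [truncKernel, truncKernelDeriv, mul_inv_cancel₀ hm.ne']
  rw [hz.1, hz.2] at key
  linear_combination key

/-- The time derivative of the Laplace transform of the shifted price. -/
noncomputable def laplaceRate (K ρ : ℝ) (α : ℝ → ℝ) (P : ℝ → ℝ → ℝ) (θ t : ℝ) : ℝ :=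
  (θ ^ 2 + ρ * θ) * realLaplace (fun V => V * shiftedPrice K α P V t) θ +
    (α t * θ ^ 2 - 2 * θ + ρ * α t * θ + deriv α t * θ - 2 * ρ) *
      realLaplace (fun V => shiftedPrice K α P V t) θ - ρ * K / θ

theorem continuousOn_mul_shiftedPrice (h : IsAmericanPutSolution K ρ α P) :
    ContinuousOn (fun p : ℝ × ℝ => p.1 * shiftedPrice K α P p.1 p.2) (Ici 0 ×ˢ Ici 0) :=
  continuousOn_fst.mul h.continuousOn_shiftedPrice

theorem abs_mul_le_of_abs_le {f : ℝ → ℝ} {C V : ℝ} (hV : 0 ≤ V)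
    (hf : |f V| ≤ C * (1 + V) ^ 1) : |V * f V| ≤ C * (1 + V) ^ 2 := by
  rw [abs_mul, abs_of_nonneg hV]
  calc V * |f V| ≤ (1 + V) * (C * (1 + V) ^ 1) := by
        gcongr
        linarith
    _ = _ := by ring

theorem exists_abs_mul_shiftedPrice_le (h : IsAmericanPutSolution K ρ α P) {T : ℝ} (hT : 0 < T) :
    ∃ C, ∀ t ∈ Icc 0 T, ∀ V, 0 ≤ V → |V * shiftedPrice K α P V t| ≤ C * (1 + V) ^ 2 := by
  obtain ⟨C, hC⟩ := h.exists_abs_shiftedPrice_le hT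
  exact ⟨C, fun t ht V hV =>
    abs_mul_le_of_abs_le (f := fun V => shiftedPrice K α P V t) hV (hC t ht V hV)⟩

theorem integrableOn_exp_mul_shiftedPrice (h : IsAmericanPutSolution K ρ α P) {θ t : ℝ}
    (hθ : 0 < θ) (ht : 0 ≤ t) :
    IntegrableOn (fun V => Real.exp (-θ * V) * shiftedPrice K α P V t) (Ioi 0) := by
  obtain ⟨C, hC⟩ := h.exists_abs_shiftedPrice_le_at ht
  exact integrableOn_realLaplace hθ (h.aestronglyMeasurable_shiftedPrice ht)
    fun V hV => hC V hV.le

theorem integrableOn_exp_mul_mul_shiftedPrice (h : IsAmericanPutSolution K ρ α P) {θ t : ℝ}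
    (hθ : 0 < θ) (ht : 0 ≤ t) :
    IntegrableOn (fun V => Real.exp (-θ * V) * (V * shiftedPrice K α P V t)) (Ioi 0) := by
  obtain ⟨C, hC⟩ := h.exists_abs_shiftedPrice_le_at ht
  exact integrableOn_realLaplace (f := fun V => V * shiftedPrice K α P V t) hθ
    (continuous_id.aestronglyMeasurable.mul (h.aestronglyMeasurable_shiftedPrice ht))
    fun V hV => abs_mul_le_of_abs_le (f := fun V => shiftedPrice K α P V t) hV.le (hC V hV.le)

theorem integral_truncAdjoint_zero (h : IsAmericanPutSolution K ρ α P) {θ t : ℝ} (hθ : 0 < θ)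
    (ht : 0 ≤ t) :
    ∫ V in Ioi (0 : ℝ), (shiftedPrice K α P V t * truncAdjoint ρ (α t) (deriv α t) θ 0 V -
      ρ * K * truncKernel θ 0 V) = laplaceRate K ρ α P θ t := by
  have i0 := h.integrableOn_exp_mul_shiftedPrice hθ ht
  have i1 := h.integrableOn_exp_mul_mul_shiftedPrice hθ ht
  have i2 : IntegrableOn (fun V => Real.exp (-θ * V)) (Ioi 0) := by
    simpa using integrableOn_one_add_pow_mul_exp_neg 0 hθ
  have e2 : ∫ V in Ioi (0 : ℝ), Real.exp (-θ * V) = 1 / θ := by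
    rw [integral_exp_mul_Ioi (by linarith) 0]
    simp
  set c₁ := θ ^ 2 + ρ * θ with hc₁
  set c₀ := α t * θ ^ 2 - 2 * θ + ρ * α t * θ + deriv α t * θ - 2 * ρ with hc₀
  calc _ = ∫ V in Ioi (0 : ℝ), (c₁ * (Real.exp (-θ * V) * (V * shiftedPrice K α P V t)) +
        c₀ * (Real.exp (-θ * V) * shiftedPrice K α P V t) - ρ * K * Real.exp (-θ * V)) := by
        congr 1 with V
        rw [truncAdjoint_zero, truncKernel_zero]
        ring
    _ = _ := by
        have i3 : IntegrableOn (fun V => c₁ * (Real.exp (-θ * V) * (V * shiftedPrice K α P V t)) +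
            c₀ * (Real.exp (-θ * V) * shiftedPrice K α P V t)) (Ioi 0) :=
          (i1.const_mul c₁).add (i0.const_mul c₀)
        rw [integral_sub i3 (i2.const_mul (ρ * K)),
          integral_add (i1.const_mul c₁) (i0.const_mul c₀), integral_const_mul,
          integral_const_mul, integral_const_mul, e2, laplaceRate, realLaplace, realLaplace]
        ring

/-- Continuity in `t` serves the fundamental theorem of calculus; joint continuity serves the chain
rule along characteristics. -/
theorem continuousOn_laplaceRate (h : IsAmericanPutSolution K ρ α P) :
    ContinuousOn (fun p : ℝ × ℝ => laplaceRate K ρ α P p.1 p.2) (Ioi 0 ×ˢ Ioi 0) := by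
  have hsub : (Ioi (0 : ℝ) ×ˢ Ioi (0 : ℝ)) ⊆ Ioi 0 ×ˢ Ici 0 :=
    prod_mono subset_rfl Ioi_subset_Ici_self
  have c0 := (continuousOn_realLaplace h.continuousOn_shiftedPrice
    fun T hT => h.exists_abs_shiftedPrice_le hT).mono hsub
  have c1 := (continuousOn_realLaplace h.continuousOn_mul_shiftedPrice
    fun T hT => h.exists_abs_mul_shiftedPrice_le hT).mono hsub
  have ca : ContinuousOn (fun p : ℝ × ℝ => α p.2) (Ioi 0 ×ˢ Ioi 0) :=
    h.boundary_continuousOn.comp continuousOn_snd fun p hp => (hsub hp).2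
  have cb : ContinuousOn (fun p : ℝ × ℝ => deriv α p.2) (Ioi 0 ×ˢ Ioi 0) :=
    h.continuousOn_deriv_boundary.comp continuousOn_snd fun p hp => hp.2
  have cf : ContinuousOn (fun p : ℝ × ℝ => p.1) (Ioi 0 ×ˢ Ioi 0) := continuousOn_fst
  unfold laplaceRate
  refine ((ContinuousOn.mul (by fun_prop) c1).add (ContinuousOn.mul ?_ c0)).sub
    (continuousOn_const.div cf fun p hp => ne_of_gt hp.1)
  exact ((((ca.mul (cf.pow 2)).sub (continuousOn_const.mul cf)).add
    ((continuousOn_const.mul ca).mul cf)).add (cb.mul cf)).sub continuousOn_const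

theorem hasDerivAt_integral_truncKernel (h : IsAmericanPutSolution K ρ α P) {θ m t : ℝ}
    (ht : 0 < t) (hm : 0 < m) (hm1 : m < 1) :
    HasDerivAt (fun t => ∫ V in m..m⁻¹, truncKernel θ m V * shiftedPrice K α P V t)
      (∫ V in m..m⁻¹, truncKernel θ m V * shiftedTheta α P V t) t := by
  have hmi : m ≤ m⁻¹ := hm1.le.trans (one_le_inv₀ hm |>.2 hm1.le)
  have hsub : Icc m m⁻¹ ×ˢ Icc (t - t / 2) (t + t / 2) ⊆ Ioi 0 ×ˢ Ioi 0 := by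
    rintro ⟨V, s⟩ ⟨hV, hs⟩
    exact ⟨hm.trans_le hV.1, lt_of_lt_of_le (by linarith) hs.1⟩
  have hk : ContinuousOn (fun p : ℝ × ℝ => truncKernel θ m p.1)
      (Icc m m⁻¹ ×ˢ Icc (t - t / 2) (t + t / 2)) :=
    ((continuous_truncKernel θ m).comp continuous_fst).continuousOn
  refine hasDerivAt_intervalIntegral_of_continuousOn (r := t / 2)
    (f := fun V t => truncKernel θ m V * shiftedPrice K α P V t)
    (f' := fun V t => truncKernel θ m V * shiftedTheta α P V t) hmi (by linarith)
    (hk.mul (h.continuousOn_shiftedPrice.mono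
      (hsub.trans (prod_mono Ioi_subset_Ici_self Ioi_subset_Ici_self))))
    (hk.mul (h.continuousOn_shiftedTheta.mono hsub)) fun V hV s hs => ?_
  have hp := hsub (show (V, s) ∈ _ from ⟨hV, hs⟩)
  exact (h.hasDerivAt_shiftedPrice_right hp.2 hp.1).const_mul _

theorem tendsto_integral_truncKernel (h : IsAmericanPutSolution K ρ α P) {θ t : ℝ}
    (hθ : 0 < θ) (ht : 0 ≤ t) :
    Tendsto (fun m => ∫ V in m..m⁻¹, truncKernel θ m V * shiftedPrice K α P V t) (𝓝[>] 0)
      (𝓝 (realLaplace (fun V => shiftedPrice K α P V t) θ)) := by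
  have hw : ContinuousOn (fun V => shiftedPrice K α P V t) (Ioi 0) :=
    h.continuousOn_shiftedPrice.comp (by fun_prop : ContinuousOn (fun V : ℝ => (V, t)) (Ioi 0))
      fun V (hV : 0 < V) => ⟨hV.le, ht⟩
  refine tendsto_intervalIntegral_inv (g := fun m V => truncKernel θ m V * shiftedPrice K α P V t)
    (B := fun V => |Real.exp (-θ * V) * shiftedPrice K α P V t|)
    (fun m _ _ => (continuous_truncKernel θ m).continuousOn.mul hw)
    (h.integrableOn_exp_mul_shiftedPrice hθ ht).abs ?_ ?_
  · intro m hm hm1 V hV hmV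
    rw [abs_mul, abs_mul, Real.abs_exp]
    gcongr
    exact (truncKernel_bounds hθ hm.le hm1.le hV.le hmV).1
  · intro V hV
    have := (continuous_truncKernel_left θ V).tendsto 0
    rw [truncKernel_zero] at this
    exact (this.mono_left nhdsWithin_le_nhds).mul_const _

/-- Uniform bound and pointwise limit of the derivative of the truncated Laplace transform. -/
theorem truncKernel_rate (h : IsAmericanPutSolution K ρ α P) (hρ : 0 < ρ) {θ t₁ t₂ : ℝ}
    (hθ : 0 < θ) (ht₁ : 0 < t₁) (ht₂ : t₁ ≤ t₂) :
    (∃ B, ∀ m, 0 < m → m < 1 → ∀ t ∈ Icc t₁ t₂,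
      |∫ V in m..m⁻¹, truncKernel θ m V * shiftedTheta α P V t| ≤ B) ∧
    ∀ t ∈ Icc t₁ t₂, Tendsto
      (fun m => ∫ V in m..m⁻¹, truncKernel θ m V * shiftedTheta α P V t) (𝓝[>] 0)
      (𝓝 (laplaceRate K ρ α P θ t)) := by
  have hpos : ∀ t ∈ Icc t₁ t₂, 0 < t := fun t ht => ht₁.trans_le ht.1
  obtain ⟨a, ha⟩ := isCompact_Icc.exists_bound_of_continuousOn
    (h.boundary_continuousOn.mono fun t ht => (hpos t ht).le : ContinuousOn α (Icc t₁ t₂))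
  obtain ⟨b, hb⟩ := isCompact_Icc.exists_bound_of_continuousOn
    (h.continuousOn_deriv_boundary.mono fun t ht => hpos t ht :
      ContinuousOn (deriv α) (Icc t₁ t₂))
  obtain ⟨C, hC⟩ := h.exists_abs_shiftedPrice_le (T := t₂) (by linarith)
  -- The lower endpoint `V = m` tends to `0`, so `P̃_V` must be bounded up to the free boundary. Its
  -- continuity there holds only for positive times, hence `t₁ > 0`.
  obtain ⟨D, hD⟩ := (isCompact_Icc.prod isCompact_Icc).exists_bound_of_continuousOn
    (h.continuousOn_shiftedDelta.mono
      (prod_mono (fun x hx => hx.1) fun t ht => hpos t ht :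
        Icc (0 : ℝ) 1 ×ˢ Icc t₁ t₂ ⊆ Ici 0 ×ˢ Ioi 0))
  have hmem : t₁ ∈ Icc t₁ t₂ := ⟨le_rfl, ht₂⟩
  have ha0 : 0 ≤ a := (norm_nonneg _).trans (ha t₁ hmem)
  have hb0 : 0 ≤ b := (norm_nonneg _).trans (hb t₁ hmem)
  have hD0 : 0 ≤ D := (norm_nonneg _).trans (hD (0, t₁) ⟨⟨le_rfl, zero_le_one⟩, hmem⟩)
  have hC0 : 0 ≤ C := by
    have := (abs_nonneg _).trans (hC t₁ ⟨ht₁.le, ht₂⟩ 0 le_rfl)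
    simpa using this
  set E := 2 * (θ + 2) + (1 + a) * (θ + 2) ^ 2 + (θ + 2) * (ρ * (1 + a) + b) + 2 * ρ with hE
  have hE0 : 0 ≤ E := by positivity
  set Bd : ℝ → ℝ := fun V => (C * E + ρ * |K|) * ((1 + V) ^ 2 * Real.exp (-θ * V)) with hBd
  have hBi : IntegrableOn Bd (Ioi 0) :=
    (integrableOn_one_add_pow_mul_exp_neg 2 hθ).const_mul _
  have hbd : ∀ t ∈ Icc t₁ t₂, ∀ m, 0 < m → m < 1 → ∀ V, 0 < V → m * V ≤ 1 →
      |shiftedPrice K α P V t * truncAdjoint ρ (α t) (deriv α t) θ m V -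
        ρ * K * truncKernel θ m V| ≤ Bd V := by
    intro t ht m hm hm1 V hV hmV
    have h1 := abs_truncAdjoint_le hρ hθ hm.le hm1.le hV.le hmV (ha t ht) (hb t ht)
    have h2 := (truncKernel_bounds hθ hm.le hm1.le hV.le hmV).1
    have h3 := hC t ⟨(hpos t ht).le, ht.2⟩ V hV.le
    rw [← hE] at h1
    refine (abs_sub _ _).trans ?_
    rw [abs_mul, abs_mul, abs_mul, abs_of_pos hρ]
    calc _ ≤ C * (1 + V) ^ 1 * (E * (1 + V) * Real.exp (-θ * V)) +
          ρ * |K| * ((1 + V) ^ 2 * Real.exp (-θ * V)) := by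
          gcongr
          refine h2.trans (le_mul_of_one_le_left (Real.exp_pos _).le ?_)
          exact one_le_pow₀ (by linarith)
      _ = Bd V := by
          simp only [hBd]
          ring
  constructor
  · refine ⟨(∫ V in Ioi 0, Bd V) + ((1 + a) * D + (1 + (1 + a) * (θ + 2)) * (C * 2) +
      (ρ * (1 + a) + b) * (C * 2)), fun m hm hm1 t ht => ?_⟩
    rw [h.integral_truncKernel_mul_shiftedTheta (hpos t ht) hm hm1]
    refine (abs_sub _ _).trans (add_le_add ?_ ?_)
    · exact abs_intervalIntegral_inv_le hm hm1 hBi (fun V hV => by positivity) (hbd t ht m hm hm1)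
    · have hexp : Real.exp (-θ * m) ≤ 1 := Real.exp_le_one_iff.2 (by nlinarith)
      obtain ⟨k0, k1, -⟩ := truncKernel_bounds hθ hm.le hm1.le hm.le
        (mul_le_one₀ hm1.le hm.le hm1.le)
      replace k0 := k0.trans hexp
      replace k1 : |truncKernelDeriv θ m m| ≤ θ + 2 :=
        k1.trans (mul_le_of_le_one_left (by linarith) hexp)
      have hw : |shiftedPrice K α P m t| ≤ C * 2 := by
        refine (hC t ⟨(hpos t ht).le, ht.2⟩ m hm.le).trans ?_
        rw [pow_one]
        gcongr
        linarith
      have hδ : |shiftedDelta α P m t| ≤ D := hD (m, t) ⟨⟨hm.le, hm1.le⟩, ht⟩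
      have hma : |m + α t| ≤ 1 + a := by
        refine (abs_add_le _ _).trans (add_le_add ?_ (ha t ht))
        rw [abs_of_pos hm]
        exact hm1.le
      have hl : |ρ * (m + α t) + deriv α t| ≤ ρ * (1 + a) + b := by
        refine (abs_add_le _ _).trans (add_le_add ?_ (hb t ht))
        rw [abs_mul, abs_of_pos hρ]
        gcongr
      refine (abs_add_le _ _).trans (add_le_add ((abs_sub _ _).trans (add_le_add ?_ ?_)) ?_)
      · rw [abs_mul, abs_mul]
        calc _ ≤ 1 * (1 + a) * D := by gcongr
          _ = _ := by ring
      · rw [abs_mul]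
        gcongr
        refine (abs_add_le _ _).trans (add_le_add k0 ?_)
        rw [abs_mul]
        gcongr
      · rw [abs_mul, abs_mul]
        calc _ ≤ 1 * (ρ * (1 + a) + b) * (C * 2) := by gcongr
          _ = _ := by ring
  · intro t ht
    have ht0 := hpos t ht
    have hw : ContinuousOn (fun V => shiftedPrice K α P V t) (Ici 0) :=
      h.continuousOn_shiftedPrice.comp (by fun_prop : ContinuousOn (fun V : ℝ => (V, t)) (Ici 0))
        fun V hV => ⟨hV, ht0.le⟩
    have hδ : ContinuousOn (fun V => shiftedDelta α P V t) (Ici 0) :=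
      h.continuousOn_shiftedDelta.comp (by fun_prop : ContinuousOn (fun V : ℝ => (V, t)) (Ici 0))
        fun V hV => ⟨hV, ht0⟩
    -- Value matching here and smooth pasting next make all boundary terms at `V = m` vanish in the
    -- limit.
    have hw0 : Tendsto (fun V => shiftedPrice K α P V t) (𝓝[>] 0) (𝓝 0) := by
      have := (hw 0 self_mem_Ici).mono Ioi_subset_Ici_self
      rwa [ContinuousWithinAt, h.shiftedPrice_zero_left ht0.le] at this
    have hδ0 : Tendsto (fun V => shiftedDelta α P V t) (𝓝[>] 0) (𝓝 0) := by
      have := (hδ 0 self_mem_Ici).mono Ioi_subset_Ici_self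
      rwa [ContinuousWithinAt, h.shiftedDelta_zero_left ht0] at this
    have c1 : Continuous fun m => truncKernel θ m m * (m + α t) := by
      unfold truncKernel
      fun_prop
    have c2 : Continuous fun m => truncKernel θ m m + (m + α t) * truncKernelDeriv θ m m := by
      unfold truncKernel truncKernelDeriv
      fun_prop
    have c3 : Continuous fun m => truncKernel θ m m * (ρ * (m + α t) + deriv α t) := by
      unfold truncKernel
      fun_prop
    have l1 := ((c1.tendsto 0).mono_left nhdsWithin_le_nhds).mul hδ0
    have l2 := ((c2.tendsto 0).mono_left nhdsWithin_le_nhds).mul hw0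
    have l3 := ((c3.tendsto 0).mono_left nhdsWithin_le_nhds).mul hw0
    have l := (l1.sub l2).add l3
    have lI : Tendsto (fun m => ∫ V in m..m⁻¹, (shiftedPrice K α P V t *
        truncAdjoint ρ (α t) (deriv α t) θ m V - ρ * K * truncKernel θ m V)) (𝓝[>] 0)
        (𝓝 (laplaceRate K ρ α P θ t)) := by
      rw [← h.integral_truncAdjoint_zero hθ ht0.le]
      refine tendsto_intervalIntegral_inv (fun m _ _ => ?_) hBi (hbd t ht) fun V hV => ?_
      · exact ((hw.mono Ioi_subset_Ici_self).mul
          (continuous_truncAdjoint _ _ _ _ _).continuousOn).sub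
          (continuousOn_const.mul (continuous_truncKernel θ m).continuousOn)
      · exact ((((continuous_truncAdjoint_left ρ (α t) (deriv α t) θ V).tendsto 0).mono_left
          nhdsWithin_le_nhds).const_mul _).sub
          ((((continuous_truncKernel_left θ V).tendsto 0).mono_left nhdsWithin_le_nhds).const_mul _)
    have lfin := lI.sub l
    simp only [mul_zero, sub_zero, add_zero] at lfin
    refine lfin.congr' ?_
    filter_upwards [Ioo_mem_nhdsGT one_pos] with m hm
    rw [h.integral_truncKernel_mul_shiftedTheta ht0 hm.1 hm.2]

/-- The truncated identity is integrated over time before `m → 0`: then bounded pointwise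
convergence of the rates suffices, and uniform convergence is not needed. -/
theorem realLaplace_sub_eq_integral (h : IsAmericanPutSolution K ρ α P) (hρ : 0 < ρ)
    {θ t₁ t₂ : ℝ} (hθ : 0 < θ) (ht₁ : 0 < t₁) (ht₂ : t₁ ≤ t₂) :
    ∫ t in t₁..t₂, laplaceRate K ρ α P θ t =
      realLaplace (fun V => shiftedPrice K α P V t₂) θ -
        realLaplace (fun V => shiftedPrice K α P V t₁) θ := by
  obtain ⟨⟨B, hB⟩, hlim⟩ := h.truncKernel_rate hρ hθ ht₁ ht₂
  have hev : ∀ᶠ m : ℝ in 𝓝[>] 0, 0 < m ∧ m < 1 := Ioo_mem_nhdsGT one_pos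
  have hsub : uIoc t₁ t₂ ⊆ Icc t₁ t₂ := by
    rw [uIoc_of_le ht₂]
    exact Ioc_subset_Icc_self
  have hmeas : ∀ m, 0 < m → m < 1 → AEStronglyMeasurable
      (fun t => ∫ V in m..m⁻¹, truncKernel θ m V * shiftedTheta α P V t)
      (volume.restrict (uIoc t₁ t₂)) := by
    intro m hm hm1
    -- Measurability in `t` comes for free, the function being a derivative on this interval.
    refine (aestronglyMeasurable_deriv
      (fun t => ∫ V in m..m⁻¹, truncKernel θ m V * shiftedPrice K α P V t) _).congr ?_
    filter_upwards [ae_restrict_mem measurableSet_uIoc] with t ht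
    exact (h.hasDerivAt_integral_truncKernel (ht₁.trans_le (hsub ht).1) hm hm1).deriv
  have hftc : ∀ m, 0 < m → m < 1 →
      ∫ t in t₁..t₂, (∫ V in m..m⁻¹, truncKernel θ m V * shiftedTheta α P V t) =
      (∫ V in m..m⁻¹, truncKernel θ m V * shiftedPrice K α P V t₂) -
        ∫ V in m..m⁻¹, truncKernel θ m V * shiftedPrice K α P V t₁ := by
    intro m hm hm1
    refine intervalIntegral.integral_eq_sub_of_hasDerivAt
      (f := fun t => ∫ V in m..m⁻¹, truncKernel θ m V * shiftedPrice K α P V t)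
      (fun t ht => ?_) ?_
    · rw [uIcc_of_le ht₂] at ht
      exact h.hasDerivAt_integral_truncKernel (ht₁.trans_le ht.1) hm hm1
    · refine (intervalIntegrable_const (c := B) (μ := volume)).mono_fun' (hmeas m hm hm1) ?_
      filter_upwards [ae_restrict_mem measurableSet_uIoc] with t ht using hB m hm hm1 t (hsub ht)
  have l1 : Tendsto (fun m => ∫ t in t₁..t₂,
      (∫ V in m..m⁻¹, truncKernel θ m V * shiftedTheta α P V t)) (𝓝[>] 0)
      (𝓝 (∫ t in t₁..t₂, laplaceRate K ρ α P θ t)) := by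
    refine intervalIntegral.tendsto_integral_filter_of_dominated_convergence (fun _ => B) ?_ ?_
      intervalIntegrable_const ?_
    · filter_upwards [hev] with m hm using hmeas m hm.1 hm.2
    · filter_upwards [hev] with m hm
      exact ae_of_all _ fun t ht => hB m hm.1 hm.2 t (hsub ht)
    · exact ae_of_all _ fun t ht => hlim t (hsub ht)
  have l2 := (h.tendsto_integral_truncKernel hθ (ht₁.le.trans ht₂)).sub
    (h.tendsto_integral_truncKernel hθ ht₁.le)
  refine tendsto_nhds_unique l1 (l2.congr' ?_)
  filter_upwards [hev] with m hm using (hftc m hm.1 hm.2).symm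

theorem hasDerivAt_realLaplace_right (h : IsAmericanPutSolution K ρ α P) (hρ : 0 < ρ) {θ t : ℝ}
    (hθ : 0 < θ) (ht : 0 < t) :
    HasDerivAt (fun t => realLaplace (fun V => shiftedPrice K α P V t) θ)
      (laplaceRate K ρ α P θ t) t := by
  have hc : ContinuousOn (laplaceRate K ρ α P θ) (Ioi 0) :=
    ContinuousOn.comp (g := fun p : ℝ × ℝ => laplaceRate K ρ α P p.1 p.2)
      (f := fun t : ℝ => (θ, t)) h.continuousOn_laplaceRate (by fun_prop)
      fun t ht => ⟨hθ, ht⟩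
  have hsub : uIcc (t / 2) t ⊆ Ioi 0 := by
    rw [uIcc_of_le (by linarith)]
    exact fun s hs => lt_of_lt_of_le (by linarith) hs.1
  have hd := intervalIntegral.integral_hasDerivAt_right (a := t / 2)
    (hc.mono hsub).intervalIntegrable
    (hc.stronglyMeasurableAtFilter isOpen_Ioi t ht)
    (hc.continuousAt (Ioi_mem_nhds ht))
  refine (hd.const_add (realLaplace (fun V => shiftedPrice K α P V (t / 2)) θ)).congr_of_eventuallyEq
    ?_
  filter_upwards [Ioi_mem_nhds (show t / 2 < t by linarith)] with s hs
  rw [h.realLaplace_sub_eq_integral hρ hθ (by linarith) (le_of_lt hs)]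
  ring

end IsAmericanPutSolution

/-! ### Characteristics of the transformed equation. -/

/-- The time at which the characteristic through `(θ, t)` of the transformed equation reaches
`ρ z`. -/
noncomputable def charTime (ρ θ t z : ℝ) : ℝ :=
  t + ρ⁻¹ * Real.log ((θ + ρ) / θ * (z / (z + 1)))

theorem charTime_left {ρ θ : ℝ} (hρ : 0 < ρ) (hθ : 0 < θ) (t : ℝ) :
    charTime ρ θ t (θ / ρ) = t := by
  have : (θ + ρ) / θ * (θ / ρ / (θ / ρ + 1)) = 1 := by
    field_simp
  rw [charTime, this, Real.log_one, mul_zero, add_zero]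

/-- The characteristic equation `dθ/dt = θ² + ρθ`, inverted and written with `θ = ρz`. -/
theorem hasDerivAt_charTime {ρ θ z : ℝ} (hρ : 0 < ρ) (hθ : 0 < θ) (hz : 0 < z) (t : ℝ) :
    HasDerivAt (charTime ρ θ t) (1 / (ρ * z * (z + 1))) z := by
  have h1 : HasDerivAt (fun z : ℝ => z / (z + 1)) ((1 * (z + 1) - z * 1) / (z + 1) ^ 2) z :=
    (hasDerivAt_id z).div ((hasDerivAt_id z).add_const 1) (by positivity)
  have h2 := ((h1.const_mul ((θ + ρ) / θ)).log (by positivity)).const_mul ρ⁻¹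
  convert! h2.const_add t using 1
  field_simp
  ring

/-- Blow-up in finite time confines the whole characteristic to a compact time interval, on which
`α` has a positive minimum and the growth bounds are uniform. -/
theorem charTime_mem {ρ θ t z : ℝ} (hρ : 0 < ρ) (hθ : 0 < θ) (hz : θ / ρ ≤ z) :
    charTime ρ θ t z ∈ Icc t (t + ρ⁻¹ * Real.log ((θ + ρ) / θ)) := by
  have hz0 : 0 < z := lt_of_lt_of_le (by positivity) hz
  have hz1 : θ ≤ z * ρ := (div_le_iff₀ hρ).1 hz
  constructor
  · have : 1 ≤ (θ + ρ) / θ * (z / (z + 1)) := by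
      rw [div_mul_div_comm, le_div_iff₀ (by positivity)]
      nlinarith
    have := Real.log_nonneg this
    have : 0 ≤ ρ⁻¹ * Real.log ((θ + ρ) / θ * (z / (z + 1))) := by positivity
    simp only [charTime]
    linarith
  · unfold charTime
    gcongr
    refine mul_le_of_le_one_right (by positivity) ?_
    rw [div_le_one (by positivity)]
    linarith

/-- Strictness matters for characteristics starting at `t = 0`, where `α` is merely continuous: past
the starting point the time is positive and derivatives exist. -/
theorem lt_charTime {ρ θ t z : ℝ} (hρ : 0 < ρ) (hθ : 0 < θ) (hz : θ / ρ < z) :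
    t < charTime ρ θ t z := by
  have hz0 : 0 < z := lt_trans (by positivity) hz
  have hz1 : θ < z * ρ := (div_lt_iff₀ hρ).1 hz
  have : 1 < (θ + ρ) / θ * (z / (z + 1)) := by
    rw [div_mul_div_comm, lt_div_iff₀ (by positivity)]
    nlinarith
  have := Real.log_pos this
  have : 0 < ρ⁻¹ * Real.log ((θ + ρ) / θ * (z / (z + 1))) := by positivity
  simp only [charTime]
  linarith

theorem realLaplace_id {θ : ℝ} (hθ : 0 < θ) : realLaplace (fun V => V) θ = 1 / θ ^ 2 := by
  have := Real.integral_rpow_mul_exp_neg_mul_Ioi (a := 2) two_pos hθ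
  rw [Real.Gamma_two, mul_one, Real.rpow_two, one_div_pow] at this
  rw [← this, realLaplace]
  congr 1 with V
  norm_num
  ring

namespace IsAmericanPutSolution

variable {K ρ : ℝ} {α : ℝ → ℝ} {P : ℝ → ℝ → ℝ}

/-- The boundary is bounded below along a characteristic. -/
theorem exists_boundary_ge (h : IsAmericanPutSolution K ρ α P) {θ t : ℝ} (hρ : 0 < ρ)
    (hθ : 0 < θ) (ht : 0 ≤ t) :
    ∃ a, 0 < a ∧ ∀ z, θ / ρ ≤ z → a ≤ α (charTime ρ θ t z) := by
  have hc : ContinuousOn α (Icc t (t + ρ⁻¹ * Real.log ((θ + ρ) / θ))) :=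
    h.boundary_continuousOn.mono fun s hs => ht.trans hs.1
  obtain ⟨s, hs, hmin⟩ := isCompact_Icc.exists_isMinOn
    ⟨_, charTime_mem (t := t) hρ hθ le_rfl⟩ hc
  exact ⟨α s, h.boundary_pos s (ht.trans hs.1), fun z hz => hmin (charTime_mem hρ hθ hz)⟩

theorem continuousOn_charTime {θ t : ℝ} (hρ : 0 < ρ) (hθ : 0 < θ) :
    ContinuousOn (charTime ρ θ t) (Ici (θ / ρ)) := fun z hz =>
  (hasDerivAt_charTime hρ hθ (lt_of_lt_of_le (by positivity) (mem_Ici.1 hz)) t).continuousAt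
    |>.continuousWithinAt

theorem continuousOn_boundary_charTime (h : IsAmericanPutSolution K ρ α P) {θ t : ℝ} (hρ : 0 < ρ)
    (hθ : 0 < θ) (ht : 0 ≤ t) :
    ContinuousOn (fun z => α (charTime ρ θ t z)) (Ici (θ / ρ)) :=
  h.boundary_continuousOn.comp (continuousOn_charTime hρ hθ)
    fun _ hz => ht.trans (charTime_mem hρ hθ hz).1

theorem integrableOn_charIntegrand (h : IsAmericanPutSolution K ρ α P) {θ t : ℝ} (hρ : 0 < ρ)
    (hθ : 0 < θ) (ht : 0 ≤ t) : IntegrableOn (charIntegrand ρ α θ t) (Ioi (θ / ρ)) := by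
  obtain ⟨a, ha, hle⟩ := h.exists_boundary_ge hρ hθ ht
  have hz0 : ∀ z ∈ Ioi (θ / ρ), 0 < z := fun z hz => lt_trans (by positivity) (mem_Ioi.1 hz)
  have hα := (h.continuousOn_boundary_charTime hρ hθ ht).mono Ioi_subset_Ici_self
  have hc : ContinuousOn (charIntegrand ρ α θ t) (Ioi (θ / ρ)) := by
    refine ContinuousOn.mul ?_ (ContinuousOn.rexp (ContinuousOn.mul (by fun_prop) hα))
    exact continuousOn_const.div (by fun_prop) fun z hz => by linarith [hz0 z hz]
  refine (integrableOn_exp_mul_Ioi (a := -ρ * a) (by nlinarith) (θ / ρ)).mono'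
    (hc.aestronglyMeasurable measurableSet_Ioi) ?_
  filter_upwards [ae_restrict_mem measurableSet_Ioi] with z hz
  have hz1 := hz0 z hz
  have h1 : 1 / (z + 1) ≤ 1 := by
    rw [div_le_one (by positivity)]
    linarith
  have h2 : Real.exp (-ρ * z * α (charTime ρ θ t z)) ≤ Real.exp (-ρ * a * z) := by
    apply Real.exp_le_exp.2
    have := mul_le_mul_of_nonneg_left (hle z (le_of_lt hz)) (by positivity : 0 ≤ ρ * z)
    linarith
  rw [charIntegrand, Real.norm_of_nonneg (by positivity)]
  calc _ ≤ 1 * Real.exp (-ρ * a * z) := mul_le_mul h1 h2 (by positivity) zero_le_one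
    _ = _ := one_mul _

theorem hasDerivAt_realLaplace_left (h : IsAmericanPutSolution K ρ α P) {θ t : ℝ}
    (hθ : 0 < θ) (ht : 0 ≤ t) :
    HasDerivAt (fun θ => realLaplace (fun V => shiftedPrice K α P V t) θ)
      (-realLaplace (fun V => V * shiftedPrice K α P V t) θ) θ := by
  obtain ⟨C, hC⟩ := h.exists_abs_shiftedPrice_le_at ht
  exact hasDerivAt_realLaplace hθ (h.aestronglyMeasurable_shiftedPrice ht)
    fun V hV => hC V hV.le

theorem continuousOn_realLaplace_shiftedPrice (h : IsAmericanPutSolution K ρ α P) :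
    ContinuousOn (fun p : ℝ × ℝ => realLaplace (fun V => shiftedPrice K α P V p.2) p.1)
      (Ioi 0 ×ˢ Ici 0) :=
  continuousOn_realLaplace h.continuousOn_shiftedPrice fun _ hT => h.exists_abs_shiftedPrice_le hT

/-- The transform along a characteristic, with its integrating factor. -/
noncomputable def charFlow (K ρ : ℝ) (α : ℝ → ℝ) (P : ℝ → ℝ → ℝ) (θ t z : ℝ) : ℝ :=
  (ρ * z) ^ 2 * Real.exp (-ρ * z * α (charTime ρ θ t z)) *
    realLaplace (fun V => shiftedPrice K α P V (charTime ρ θ t z)) (ρ * z)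

/-- Along a characteristic the coefficient of the transform is `d/dz (ρzα) - 2/z`, which the
integrating factor cancels; only the source `-ρK/θ` remains. -/
theorem hasDerivAt_charFlow (h : IsAmericanPutSolution K ρ α P) {θ t z : ℝ} (hρ : 0 < ρ)
    (hθ : 0 < θ) (ht : 0 ≤ t) (hz : θ / ρ < z) :
    HasDerivAt (charFlow K ρ α P θ t) (-(ρ * K) * charIntegrand ρ α θ t z) z := by
  have hz0 : 0 < z := lt_trans (by positivity) hz
  have hs : 0 < charTime ρ θ t z := ht.trans_lt (lt_charTime hρ hθ hz)
  have hρz : 0 < ρ * z := by positivity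
  have dT := hasDerivAt_charTime hρ hθ hz0 t
  have dρ : HasDerivAt (fun z => ρ * z) ρ z := by
    simpa using (hasDerivAt_id z).const_mul ρ
  have hopen : (Ioi (0 : ℝ) ×ˢ Ioi (0 : ℝ)) ∈ 𝓝 (ρ * z, charTime ρ θ t z) :=
    (isOpen_Ioi.prod isOpen_Ioi).mem_nhds ⟨hρz, hs⟩
  have c1 : ContinuousAt (fun p : ℝ × ℝ =>
      -realLaplace (fun V => V * shiftedPrice K α P V p.2) p.1) (ρ * z, charTime ρ θ t z) :=
    (((continuousOn_realLaplace h.continuousOn_mul_shiftedPrice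
      fun T hT => h.exists_abs_mul_shiftedPrice_le hT).mono
      (prod_mono subset_rfl Ioi_subset_Ici_self)).continuousAt hopen).neg
  have dQ := hasDerivAt_comp_of_partial
    (f := fun θ t => realLaplace (fun V => shiftedPrice K α P V t) θ)
    (f₁ := fun θ t => -realLaplace (fun V => V * shiftedPrice K α P V t) θ)
    (f₂ := fun θ t => laplaceRate K ρ α P θ t)
    (a := fun z => ρ * z) (b := charTime ρ θ t) (s := z)
    (by
      filter_upwards [hopen] with p hp
      exact h.hasDerivAt_realLaplace_left hp.1 (le_of_lt hp.2))
    (by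
      filter_upwards [hopen] with p hp
      exact h.hasDerivAt_realLaplace_right hρ hp.1 hp.2)
    c1 (h.continuousOn_laplaceRate.continuousAt hopen) dρ dT
  have dα : HasDerivAt (fun z => α (charTime ρ θ t z))
      (deriv α (charTime ρ θ t z) * (1 / (ρ * z * (z + 1)))) z :=
    (h.hasDerivAt_boundary hs).comp z dT
  have dn : HasDerivAt (fun z => -ρ * z) (-ρ) z := by
    simpa using (hasDerivAt_id z).const_mul (-ρ)
  convert! ((dρ.pow 2).mul (dn.mul dα).exp).mul dQ using 1
  simp only [charIntegrand, laplaceRate, Pi.mul_apply, Pi.pow_apply]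
  rw [← charTime]
  field_simp
  ring

theorem continuousOn_charFlow (h : IsAmericanPutSolution K ρ α P) {θ t : ℝ} (hρ : 0 < ρ)
    (hθ : 0 < θ) (ht : 0 ≤ t) : ContinuousOn (charFlow K ρ α P θ t) (Ici (θ / ρ)) := by
  have hα := h.continuousOn_boundary_charTime hρ hθ ht
  refine ContinuousOn.mul (ContinuousOn.mul (by fun_prop)
    (ContinuousOn.rexp (ContinuousOn.mul (by fun_prop) hα))) ?_
  refine ContinuousOn.comp
    (g := fun p : ℝ × ℝ => realLaplace (fun V => shiftedPrice K α P V p.2) p.1)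
    (f := fun z => (ρ * z, charTime ρ θ t z)) h.continuousOn_realLaplace_shiftedPrice
    (ContinuousOn.prodMk (by fun_prop) (continuousOn_charTime hρ hθ)) fun z hz => ⟨?_, ?_⟩
  · exact mul_pos hρ (lt_of_lt_of_le (by positivity) (mem_Ici.1 hz))
  · exact ht.trans (charTime_mem hρ hθ hz).1

/-- The transform stays bounded, since `ρz ≥ θ` and the times are confined, while `α ≥ a > 0` gives
the decay `exp(-aρz)`, which beats `(ρz)²`. -/
theorem tendsto_charFlow (h : IsAmericanPutSolution K ρ α P) {θ t : ℝ} (hρ : 0 < ρ)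
    (hθ : 0 < θ) (ht : 0 ≤ t) : Tendsto (charFlow K ρ α P θ t) atTop (𝓝 0) := by
  obtain ⟨a, ha, hle⟩ := h.exists_boundary_ge hρ hθ ht
  set T := t + ρ⁻¹ * Real.log ((θ + ρ) / θ) with hT
  have htT : t ≤ T := (charTime_mem (t := t) hρ hθ le_rfl).1.trans (charTime_mem hρ hθ le_rfl).2
  obtain ⟨C, hC⟩ := h.exists_abs_shiftedPrice_le (T := T + 1) (by linarith)
  set B := ∫ V in Ioi (0 : ℝ), C * ((1 + V) ^ 1 * Real.exp (-θ * V)) with hB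
  have hQ : ∀ z, θ / ρ ≤ z →
      |realLaplace (fun V => shiftedPrice K α P V (charTime ρ θ t z)) (ρ * z)| ≤ B := by
    intro z hz
    have hmem := charTime_mem (t := t) hρ hθ hz
    have hz1 : θ ≤ ρ * z := by
      rw [mul_comm]
      exact (div_le_iff₀ hρ).1 hz
    rw [← Real.norm_eq_abs]
    refine norm_integral_le_of_norm_le
      ((integrableOn_one_add_pow_mul_exp_neg 1 hθ).const_mul C) ?_
    filter_upwards [ae_restrict_mem measurableSet_Ioi] with V hV
    have hV' : 0 < V := hV
    rw [norm_mul, Real.norm_eq_abs, Real.abs_exp, Real.norm_eq_abs]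
    calc _ ≤ Real.exp (-θ * V) * (C * (1 + V) ^ 1) := by
          gcongr
          exact hC _ ⟨ht.trans hmem.1, hmem.2.trans (by linarith)⟩ V hV'.le
      _ = _ := by ring
  have hlim : Tendsto (fun z => B * (a ^ 2)⁻¹ *
      ((a * ρ * z) ^ 2 * Real.exp (-(a * ρ * z)))) atTop (𝓝 0) := by
    have h1 : Tendsto (fun z : ℝ => a * ρ * z) atTop atTop :=
      tendsto_id.const_mul_atTop (by positivity)
    simpa using ((Real.tendsto_pow_mul_exp_neg_atTop_nhds_zero 2).comp h1).const_mul
      (B * (a ^ 2)⁻¹)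
  refine squeeze_zero_norm' ?_ hlim
  filter_upwards [eventually_ge_atTop (θ / ρ)] with z hz
  have hz0 : 0 < z := lt_of_lt_of_le (by positivity) hz
  have hexp : Real.exp (-ρ * z * α (charTime ρ θ t z)) ≤ Real.exp (-(a * ρ * z)) := by
    apply Real.exp_le_exp.2
    have := mul_le_mul_of_nonneg_left (hle z hz) (by positivity : 0 ≤ ρ * z)
    linarith
  rw [charFlow, norm_mul, norm_mul, Real.norm_of_nonneg (sq_nonneg _), Real.norm_eq_abs,
    Real.abs_exp, Real.norm_eq_abs]
  calc _ ≤ (ρ * z) ^ 2 * Real.exp (-(a * ρ * z)) * B := by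
        gcongr
        exact hQ z hz
    _ = _ := by
        field_simp

/-! ### The explicit formula and its consequences. -/

/-- The explicit formula is the Laplace transform of the shifted price. -/
theorem charQ_eq_realLaplace (h : IsAmericanPutSolution K ρ α P) {θ t : ℝ} (hρ : 0 < ρ)
    (hθ : 0 < θ) (ht : 0 ≤ t) :
    charQ K ρ α θ t = realLaplace (fun V => shiftedPrice K α P V t) θ := by
  -- The flow ends at `0`, so the integral of its derivative is minus its value at `z = θ/ρ`, the
  -- point `(θ, t)` itself. Mere continuity at that endpoint is enough, which admits `t = 0`.
  have key := integral_Ioi_of_hasDerivAt_of_tendsto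
    (h.continuousOn_charFlow hρ hθ ht (θ / ρ) self_mem_Ici)
    (fun z hz => h.hasDerivAt_charFlow hρ hθ ht hz)
    ((h.integrableOn_charIntegrand hρ hθ ht).const_mul (-(ρ * K))) (h.tendsto_charFlow hρ hθ ht)
  rw [integral_const_mul, charFlow, charTime_left hρ hθ, mul_div_cancel₀ θ hρ.ne'] at key
  have hexp : Real.exp (α t * θ) * Real.exp (-ρ * (θ / ρ) * α t) = 1 := by
    rw [← Real.exp_add, Real.exp_eq_one_iff]
    field_simp
    ring
  rw [charQ, div_mul_eq_mul_div, div_mul_eq_mul_div, div_eq_iff (by positivity)]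
  linear_combination (-Real.exp (α t * θ)) * key +
    θ ^ 2 * realLaplace (fun V => shiftedPrice K α P V t) θ * hexp

theorem charQ_zero_right (h : IsAmericanPutSolution K ρ α P) {θ : ℝ} (hρ : 0 < ρ) (hθ : 0 < θ) :
    charQ K ρ α θ 0 = 1 / θ ^ 2 := by
  rw [h.charQ_eq_realLaplace hρ hθ le_rfl, ← realLaplace_id hθ, realLaplace, realLaplace]
  refine setIntegral_congr_fun measurableSet_Ioi fun V (hV : 0 < V) => ?_
  simp only [h.shiftedPrice_zero_right hV.le]

theorem hasDerivAt_charQ_right (h : IsAmericanPutSolution K ρ α P) {θ t : ℝ} (hρ : 0 < ρ)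
    (hθ : 0 < θ) (ht : 0 < t) :
    HasDerivAt (fun τ => charQ K ρ α θ τ) (laplaceRate K ρ α P θ t) t := by
  refine (h.hasDerivAt_realLaplace_right hρ hθ ht).congr_of_eventuallyEq ?_
  filter_upwards [Ioi_mem_nhds ht] with s hs using h.charQ_eq_realLaplace hρ hθ (le_of_lt hs)

theorem hasDerivAt_charQ_left (h : IsAmericanPutSolution K ρ α P) {θ t : ℝ} (hρ : 0 < ρ)
    (hθ : 0 < θ) (ht : 0 ≤ t) :
    HasDerivAt (fun x => charQ K ρ α x t)
      (-realLaplace (fun V => V * shiftedPrice K α P V t) θ) θ := by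
  refine (h.hasDerivAt_realLaplace_left hθ ht).congr_of_eventuallyEq ?_
  filter_upwards [Ioi_mem_nhds hθ] with x hx using h.charQ_eq_realLaplace hρ hx ht

theorem norm_ofReal_shiftedPrice_le (h : IsAmericanPutSolution K ρ α P) {t : ℝ} (ht : 0 ≤ t) :
    ∃ C, ∀ V, 0 < V → ‖(shiftedPrice K α P V t : ℂ)‖ ≤ C * (1 + V) ^ 1 := by
  obtain ⟨C, hC⟩ := h.exists_abs_shiftedPrice_le_at ht
  exact ⟨C, fun V hV => by simpa using hC V hV.le⟩

theorem aestronglyMeasurable_ofReal_shiftedPrice (h : IsAmericanPutSolution K ρ α P) {t : ℝ}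
    (ht : 0 ≤ t) : AEStronglyMeasurable (fun V => (shiftedPrice K α P V t : ℂ))
      (volume.restrict (Ioi 0)) :=
  Complex.continuous_ofReal.comp_aestronglyMeasurable (h.aestronglyMeasurable_shiftedPrice ht)

theorem integrableOn_laplace_shiftedPrice (h : IsAmericanPutSolution K ρ α P) {t : ℝ} {θ : ℂ}
    (ht : 0 ≤ t) (hθ : 0 < θ.re) :
    IntegrableOn (fun V : ℝ => Complex.exp (-θ * V) * (shiftedPrice K α P V t : ℂ)) (Ioi 0) := by
  obtain ⟨C, hC⟩ := h.norm_ofReal_shiftedPrice_le ht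
  exact integrableOn_laplace hθ (h.aestronglyMeasurable_ofReal_shiftedPrice ht) hC

end IsAmericanPutSolution

theorem mainTheorem1 (K ρ : ℝ) (hK : 0 < K) (hρ : 0 < ρ) (α : ℝ → ℝ) (P : ℝ → ℝ → ℝ)
    (h : IsAmericanPutSolution K ρ α P) :
    -- `Q(·, t)`: the Laplace transform of `P̃(·, t)`, the holomorphic extension of the explicit
    -- formula from `θ > 0` to `Re θ > 0`, and the Bromwich representation of the price
    (∃ Q : ℂ → ℝ → ℂ, ∀ t : ℝ, 0 ≤ t →
      DifferentiableOn ℂ (fun θ => Q θ t) {θ : ℂ | 0 < θ.re} ∧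
      (∀ θ : ℝ, 0 < θ →
        IntegrableOn (charIntegrand ρ α θ t) (Ioi (θ / ρ)) ∧
        Q (θ : ℂ) t = (charQ K ρ α θ t : ℂ)) ∧
      (∀ θ : ℂ, 0 < θ.re →
        IntegrableOn (fun V : ℝ => Complex.exp (-θ * V) * (shiftedPrice K α P V t : ℂ)) (Ioi 0) ∧
        Q θ t = ∫ V in Ioi (0 : ℝ), Complex.exp (-θ * V) * (shiftedPrice K α P V t : ℂ)) ∧
      (∀ c : ℝ, 0 < c → ∀ S : ℝ, 0 < S →
        ∃ B : ℂ,
          HasBromwichIntegral (fun θ => Complex.exp (θ * ((S - α t : ℝ) : ℂ)) * Q θ t) c B ∧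
          (P S t : ℂ) = (K : ℂ) - (S : ℂ) + B)) ∧
    -- the explicit formula solves the transformed equation, with its initial condition
    (∀ θ t : ℝ, 0 < θ → 0 < t →
      DifferentiableAt ℝ (fun τ => charQ K ρ α θ τ) t ∧
      DifferentiableAt ℝ (fun x => charQ K ρ α x t) θ ∧
      deriv (fun τ => charQ K ρ α θ τ) t +
          (θ ^ 2 + ρ * θ) * deriv (fun x => charQ K ρ α x t) θ =
        (deriv α t * θ + (θ ^ 2 + ρ * θ) * α t - (2 * θ + 2 * ρ)) * charQ K ρ α θ t
          - ρ * K / θ) ∧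
    (∀ θ : ℝ, 0 < θ → charQ K ρ α θ 0 = 1 / θ ^ 2) ∧
    -- the integral equation for the free boundary
    (∀ θ : ℝ, 0 < θ →
      Real.exp (-K * θ) / (K * ρ) =
        ∫ z in Ioi (θ / ρ), 1 / (z + 1) *
          Real.exp (-ρ * z * α (ρ⁻¹ * Real.log ((θ + ρ) / θ * (z / (z + 1)))))) := by
  -- The extension is taken to be the complex Laplace transform itself: holomorphy is then
  -- automatic, and agreement with (1) has to be checked only for real `θ`.
  refine ⟨⟨fun θ t => ∫ V in Ioi (0 : ℝ), Complex.exp (-θ * V) * (shiftedPrice K α P V t : ℂ),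
    fun t ht => ⟨?_, ?_, ?_, ?_⟩⟩, ?_, ?_, ?_⟩
  · intro θ hθ
    obtain ⟨C, hC⟩ := h.norm_ofReal_shiftedPrice_le ht
    exact (hasDerivAt_laplace hθ (h.aestronglyMeasurable_ofReal_shiftedPrice ht)
      hC).differentiableAt.differentiableWithinAt
  · intro θ hθ
    refine ⟨h.integrableOn_charIntegrand hρ hθ ht, ?_⟩
    rw [h.charQ_eq_realLaplace hρ hθ ht]
    exact laplace_ofReal _ _
  · exact fun θ hθ => ⟨h.integrableOn_laplace_shiftedPrice ht hθ, rfl⟩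
  · intro c hc S hS
    refine ⟨_, hasBromwichIntegral_laplace
      (h.integrableOn_laplace_shiftedPrice ht (θ := (c : ℂ)) (by simpa using hc))
      (h.indicator_shiftedPrice_sub_isBigO ht hS), ?_⟩
    rw [h.indicator_shiftedPrice_eq ht hS]
    ring
  · intro θ t hθ ht
    have d1 := h.hasDerivAt_charQ_right hρ hθ ht
    have d2 := h.hasDerivAt_charQ_left hρ hθ ht.le
    refine ⟨d1.differentiableAt, d2.differentiableAt, ?_⟩
    rw [d1.deriv, d2.deriv, h.charQ_eq_realLaplace hρ hθ ht.le, IsAmericanPutSolution.laplaceRate]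
    ring
  · exact fun θ hθ => h.charQ_zero_right hρ hθ
  · intro θ hθ
    -- At `t = 0` the formula must equal `θ⁻²`; the powers of `θ` cancel and `α 0 = K` supplies the
    -- factor `exp(Kθ)`.
    have h1 := h.charQ_zero_right hρ hθ
    have h2 : charIntegrand ρ α θ 0 = fun z => 1 / (z + 1) *
        Real.exp (-ρ * z * α (ρ⁻¹ * Real.log ((θ + ρ) / θ * (z / (z + 1))))) := by
      funext z
      rw [charIntegrand, zero_add]
    rw [charQ, h.boundary_zero, h2] at h1
    rw [neg_mul, Real.exp_neg]
    generalize (∫ z in Ioi (θ / ρ), _ : ℝ) = J at h1 ⊢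
    field_simp at h1 ⊢
    linear_combination -h1
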